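/- **Setting.** Let $b\in(0,\infty]$ and let $q$ be a real-valued potential on $(0,b)$ together with a boundary condition at $b$, of one of the following kinds. 1. $b<\infty$, $q\in L^1((0,b))$, with the boundary condition $u'(b_-)+hu(b_-)=0$ for some $h\in\mathbb R$, or $u(b_-)=0$ ($h=\infty$). 2. $b=\infty$, $q\in L^1((0,R))$ for all $R<\infty$, and either $\sup_{x>0}\int_x^{x+1}\max(-q(y),0)\,dy<\infty$, or $-\frac{d^2}{dx^2}+q$ is limit point at infinity (for each $z$ with $\operatorname{Im}z>0$, $-u''+qu=zu$ has, up to constant multiples, exactly one nonzero solution that is $L^2$ at infinity). The boundary condition is that $u$ is $L^2$ at infinity. 3. $b=\infty$, $q\in L^1((0,R))$ for all $R<\infty$, and $-\frac{d^2}{dx^2}+q$ is limit circle at infinity (for each $z$ with $\operatorname{Im}z>0$, all solutions of $-u''+qu=zu$ are $L^2$ at infinity). The boundary condition is $\lim_{x\to\infty}[u_0(x)u'(x)-u_0'(x)u(x)]=0$, where $u_0\ne0$ is a fixed solution of $-u_0''+qu_0=iu_0$ with $\lim_{x\to\infty}\operatorname{Im}(\overline{u_0(x)}\,u_0'(x))=0$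 (so that the condition is self-adjoint). Solutions are functions $u$ with $u,u'$ locally absolutely continuous that satisfy the equation almost everywhere. For $z\in\mathbb C\setminus\mathbb R$ the Weyl–Titchmarsh function is $m(z)=u'(0_+)/u(0_+)$, where $u$ is any nonzero solution of $-u''+qu=zu$ satisfying the boundary condition at $b$. **Theorem.** Let $q_1,q_2$ be two such potentials, on $(0,b_1)$ and $(0,b_2)$, with boundary conditions as above and Weyl–Titchmarsh functions $m_1,m_2$. Let $a\ge0$ and $\delta>0$ be real with $a+\delta\le\min(b_1,b_2)$, suppose that $q_1=q_2$ a.e. on $[0,a]$, and put $$\eta=\max_{j=1,2}\ \sup_{0\le x\le a}\int_x^{x+\delta}|q_j(y)|\,dy .$$ (i) For every $\varepsilon>0$ there are a constant $C$, depending only on $\varepsilon$, $\delta$ and (an upper bound for) $\eta$, and a number $K_0$, depending only on these and on $a$, such that $$|m_1(-\kappa^2)-m_2(-\kappa^2)|\le C\exp(-2a\operatorname{Re}\kappa)$$ for all $\kappa\in\mathbb C$ with $-\frac\pi2+\varepsilon<\arg\kappa<-\varepsilon$ and $|\kappa|\ge K_0$. (ii) For all $\kappa\in\mathbb C$ with $\operatorname{Re}\kappa\ge\max(4\eta,\delta^{-1}\ln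 6)$ and $\operatorname{Im}\kappa\ne0$, $$|m_1(-\kappa^2)-m_2(-\kappa^2)|\le 2F(\kappa)\exp\bigl(-2a[\operatorname{Re}\kappa-F(\kappa)]\bigr),\qquad F(\kappa)=2\eta+\frac{864}{5}\,\frac{|\kappa|^2}{|\operatorname{Im}\kappa|}\,e^{-2\delta\operatorname{Re}\kappa}.$$ In both parts $m_1(-\kappa^2)$ and $m_2(-\kappa^2)$ exist: solutions $u$ as above exist, have $u(0_+)\ne0$, and the quotient $u'(0_+)/u(0_+)$ does not depend on the choice of $u$. -/

import Mathlib

open MeasureTheory Filter Topology Set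

noncomputable section

namespace Schrodinger

/-- `u` solves `-u'' + q u = z u` on the interval `I` (which contains its left endpoint `0`), with
derivative `u'`: `u` is differentiable on `I` with derivative `u'` (one-sided at endpoints), `u'` is
absolutely continuous on every compact interval `[0, c] ⊆ I`, and the equation holds almost
everywhere. At the endpoints belonging to `I` the potential is integrable, so `u` and `u'` are
given there by their limits. -/
structure IsSolution (q : ℝ → ℝ) (z : ℂ) (I : Set ℝ) (u u' : ℝ → ℂ) : Prop where
  hasDeriv : ∀ x ∈ I, HasDerivWithinAt u (u' x) I x
  absCont : ∀ c ∈ I, AbsolutelyContinuousOnInterval u' 0 c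
  equation : ∀ᵐ x ∂(volume.restrict I), HasDerivAt u' (((q x : ℂ) - z) * u x) x

/-- `u` does not vanish identically on `I`. -/
def IsNonzeroOn (I : Set ℝ) (u : ℝ → ℂ) : Prop := ∃ x ∈ I, u x ≠ 0

/-- `u` is square integrable near infinity. -/
def IsL2AtInfinity (u : ℝ → ℂ) : Prop :=
  ∃ R : ℝ, 0 ≤ R ∧ IntegrableOn (fun x => ‖u x‖ ^ 2) (Ioi R)

/-- `q` is integrable on `(0, R)` for all finite `R`. -/
def LocallyIntegrableHalfLine (q : ℝ → ℝ) : Prop := ∀ R : ℝ, 0 < R → IntegrableOn q (Ioo 0 R)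

/-- `sup_{x > 0} ∫_x^{x+1} max(-q, 0) < ∞`. -/
def EssentiallyBoundedBelow (q : ℝ → ℝ) : Prop :=
  ∃ M : ℝ, ∀ x : ℝ, 0 < x → ∫ y in x..(x + 1), max (-q y) 0 ≤ M

/-- Limit point at infinity: for all `z` in the open upper half-plane there is, up to a
multiplicative constant, exactly one solution that is square integrable at infinity. -/
def IsLimitPoint (q : ℝ → ℝ) : Prop :=
  ∀ z : ℂ, 0 < z.im → ∃ u u' : ℝ → ℂ, IsSolution q z (Ici 0) u u' ∧ IsNonzeroOn (Ici 0) u ∧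
    IsL2AtInfinity u ∧
    ∀ v v' : ℝ → ℂ, IsSolution q z (Ici 0) v v' → IsL2AtInfinity v →
      ∃ c : ℂ, ∀ x ∈ Ici (0 : ℝ), v x = c * u x

/-- Limit circle at infinity: for all `z` in the open upper half-plane every solution is square
integrable at infinity. -/
def IsLimitCircle (q : ℝ → ℝ) : Prop :=
  ∀ z : ℂ, 0 < z.im → ∀ u u' : ℝ → ℂ, IsSolution q z (Ici 0) u u' → IsL2AtInfinity u

/-- The right endpoint `b` together with the boundary condition there.
* `regular b h`: `b < ∞`, with the condition `u'(b) + h u(b) = 0` for `h ∈ ℝ`, and `u(b) = 0` for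
  `h = ∞`;
* `squareIntegrable`: `b = ∞`, with square integrability as the only condition;
* `limitCircle u₀ u₀'`: `b = ∞`, with the condition `u₀ u' - u₀' u → 0` at infinity. -/
inductive Endpoint where
  | regular (b : ℝ) (h : OnePoint ℝ)
  | squareIntegrable
  | limitCircle (u₀ u₀' : ℝ → ℂ)

/-- The number `b ∈ (0, ∞]`. -/
def Endpoint.right : Endpoint → EReal
  | .regular b _ => (b : EReal)
  | .squareIntegrable => ⊤
  | .limitCircle _ _ => ⊤

/-- The interval `(0, b)` together with its regular endpoints. -/
def Endpoint.interval : Endpoint → Set ℝ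
  | .regular b _ => Icc 0 b
  | .squareIntegrable => Ici 0
  | .limitCircle _ _ => Ici 0

/-- The potentials considered for each kind of right endpoint. In the limit circle case the
boundary condition is given by a nonzero solution `u₀` for `z = i`; it is a self-adjoint one, i.e.
the Wronskian of `conj u₀` and `u₀`, which is `2 i Im (conj u₀ * u₀')`, tends to `0`. -/
def Endpoint.Admissible (q : ℝ → ℝ) : Endpoint → Prop
  | .regular b _ => 0 < b ∧ IntegrableOn q (Ioo 0 b)
  | .squareIntegrable =>
      LocallyIntegrableHalfLine q ∧ (EssentiallyBoundedBelow q ∨ IsLimitPoint q)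
  | .limitCircle u₀ u₀' =>
      LocallyIntegrableHalfLine q ∧ IsLimitCircle q ∧
        IsSolution q Complex.I (Ici 0) u₀ u₀' ∧ IsNonzeroOn (Ici 0) u₀ ∧
        Tendsto (fun x => ((starRingEnd ℂ) (u₀ x) * u₀' x).im) atTop (𝓝 0)

/-- The boundary condition at `b`. -/
def Endpoint.Satisfies : Endpoint → (ℝ → ℂ) → (ℝ → ℂ) → Prop
  | .regular b (some h), u, u' => u' b + (h : ℂ) * u b = 0
  | .regular b none, u, _ => u b = 0
  | .squareIntegrable, u, _ => IsL2AtInfinity u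
  | .limitCircle u₀ u₀', u, u' => Tendsto (fun x => u₀ x * u' x - u₀' x * u x) atTop (𝓝 0)

/-- A nonzero solution for the spectral parameter `z` satisfying the boundary condition at `b`. -/
def IsWeylSolution (q : ℝ → ℝ) (e : Endpoint) (z : ℂ) (u u' : ℝ → ℂ) : Prop :=
  IsSolution q z e.interval u u' ∧ IsNonzeroOn e.interval u ∧ e.Satisfies u u'

/-- `m` is the value `m(z)` of the Weyl-Titchmarsh function: there are nonzero solutions satisfying
the boundary condition at `b`, and all of them have `u(0) ≠ 0` and `u'(0) / u(0) = m`. -/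
def IsWeylM (q : ℝ → ℝ) (e : Endpoint) (z m : ℂ) : Prop :=
  (∃ u u' : ℝ → ℂ, IsWeylSolution q e z u u') ∧
    ∀ u u' : ℝ → ℂ, IsWeylSolution q e z u u' → u 0 ≠ 0 ∧ u' 0 / u 0 = m

/-- `sup_{0 ≤ x ≤ a} ∫_x^{x+δ} |q(y)| dy`. -/
def localL1Sup (a δ : ℝ) (q : ℝ → ℝ) : ℝ :=
  sSup ((fun x => ∫ y in x..(x + δ), |q y|) '' Icc 0 a)

/-- `F(κ) = 2 η + (864/5) (|κ|² / |Im κ|) exp(-2 δ Re κ)`. -/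
def boundF (η δ : ℝ) (κ : ℂ) : ℝ :=
  2 * η + 864 / 5 * (‖κ‖ ^ 2 / |κ.im|) * Real.exp (-2 * δ * κ.re)

end Schrodinger

end

noncomputable section
namespace Schrodinger

open scoped ComplexConjugate

/-! ### Primitives of integrable functions -/

theorem absolutelyContinuous_congr {f g : ℝ → ℂ} {a b : ℝ}
    (hf : AbsolutelyContinuousOnInterval f a b) (h : ∀ x ∈ uIcc a b, g x = f x) :
    AbsolutelyContinuousOnInterval g a b := by
  rw [absolutelyContinuousOnInterval_iff] at hf ⊢
  intro ε hε
  obtain ⟨δ, hδ, H⟩ := hf ε hε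
  refine ⟨δ, hδ, fun E hE hlen => ?_⟩
  refine lt_of_eq_of_lt (Finset.sum_congr rfl fun i hi => ?_) (H E hE hlen)
  have := hE.1 i hi
  rw [h _ this.1, h _ this.2]

theorem absolutelyContinuous_ofReal {f : ℝ → ℝ} {a b : ℝ}
    (hf : AbsolutelyContinuousOnInterval f a b) :
    AbsolutelyContinuousOnInterval (fun x => (f x : ℂ)) a b := by
  rw [absolutelyContinuousOnInterval_iff] at hf ⊢
  simpa only [Complex.isometry_ofReal.dist_eq] using hf

theorem absolutelyContinuous_intervalIntegral {f : ℝ → ℂ} {a b : ℝ}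
    (hf : IntervalIntegrable f volume a b) :
    AbsolutelyContinuousOnInterval (fun x => ∫ t in a..x, f t) a b := by
  have hre : IntervalIntegrable (fun x => (f x).re) volume a b := ⟨hf.1.re, hf.2.re⟩
  have him : IntervalIntegrable (fun x => (f x).im) volume a b := ⟨hf.1.im, hf.2.im⟩
  have h1 := absolutelyContinuous_ofReal
    (hre.absolutelyContinuousOnInterval_intervalIntegral (c := a) (by simp))
  have h2 := (absolutelyContinuous_ofReal
    (him.absolutelyContinuousOnInterval_intervalIntegral (c := a) (by simp))).const_smul Complex.I
  refine absolutelyContinuous_congr (h1.add h2) fun x hx => ?_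
  have hfx : IntervalIntegrable f volume a x :=
    hf.mono_set (uIcc_subset_uIcc left_mem_uIcc hx)
  have e1 : (∫ t in a..x, f t).re = ∫ t in a..x, (f t).re := by
    simpa using (Complex.reCLM.intervalIntegral_comp_comm hfx).symm
  have e2 : (∫ t in a..x, f t).im = ∫ t in a..x, (f t).im := by
    simpa using (Complex.imCLM.intervalIntegral_comp_comm hfx).symm
  apply Complex.ext <;> simp [e1, e2]

/-- `f` is a primitive on `[a, b]` of the integrable function `f'`. -/
structure IsPrimitiveOn (f f' : ℝ → ℂ) (a b : ℝ) : Prop where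
  integrable : IntervalIntegrable f' volume a b
  eq_add_integral : ∀ x ∈ Icc a b, f x = f a + ∫ t in a..x, f' t

namespace IsPrimitiveOn

variable {f f' g g' : ℝ → ℂ} {a b : ℝ}

theorem absolutelyContinuous (hab : a ≤ b) (hf : IsPrimitiveOn f f' a b) :
    AbsolutelyContinuousOnInterval f a b := by
  have hc : AbsolutelyContinuousOnInterval (fun _ : ℝ => f a) a b :=
    ((LipschitzWith.const (f a)).lipschitzOnWith (s := uIcc a b)).absolutelyContinuousOnInterval
  refine absolutelyContinuous_congr
    (hc.add (absolutelyContinuous_intervalIntegral hf.integrable)) fun x hx => ?_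
  rw [uIcc_of_le hab] at hx
  simpa using hf.eq_add_integral x hx

theorem continuousOn (hab : a ≤ b) (hf : IsPrimitiveOn f f' a b) : ContinuousOn f (Icc a b) := by
  simpa [uIcc_of_le hab] using (hf.absolutelyContinuous hab).continuousOn

theorem ae_hasDerivAt (hab : a ≤ b) (hf : IsPrimitiveOn f f' a b) :
    ∀ᵐ x, x ∈ Icc a b → HasDerivAt f (f' x) x := by
  have h1 : ∀ᵐ x : ℝ, x ≠ a := by simp [ae_iff, measure_singleton]
  have h2 : ∀ᵐ x : ℝ, x ≠ b := by simp [ae_iff, measure_singleton]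
  filter_upwards [hf.integrable.ae_hasDerivAt_integral, h1, h2] with x hx hxa hxb hxI
  have := hx (by rwa [uIcc_of_le hab]) a left_mem_uIcc
  refine (this.const_add (f a)).congr_of_eventuallyEq ?_
  have hI : Icc a b ∈ 𝓝 x :=
    Icc_mem_nhds (lt_of_le_of_ne hxI.1 hxa.symm) (lt_of_le_of_ne hxI.2 hxb)
  filter_upwards [hI] with y hy using hf.eq_add_integral y hy

theorem of_absolutelyContinuous (hab : a ≤ b) (hf : AbsolutelyContinuousOnInterval f a b)
    (hi : IntervalIntegrable f' volume a b) (h : ∀ᵐ x, x ∈ Icc a b → HasDerivAt f (f' x) x) :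
    IsPrimitiveOn f f' a b := by
  refine ⟨hi, fun x hx => ?_⟩
  obtain ⟨C, hC⟩ := (hf.sub (absolutelyContinuous_intervalIntegral hi)).const_of_ae_hasDerivAt_zero
    (by
      filter_upwards [h, hi.ae_hasDerivAt_integral] with x hx hx2 hxI
      have := (hx (by rwa [uIcc_of_le hab] at hxI)).sub (hx2 hxI a left_mem_uIcc)
      simpa using this)
  have h1 := hC a left_mem_uIcc
  have h2 := hC x (by rwa [uIcc_of_le hab])
  simp only [Pi.sub_apply, intervalIntegral.integral_same, sub_zero] at h1 h2
  rw [h1, ← h2]; ring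

theorem of_hasDerivAt (hf : ∀ x, HasDerivAt f (f' x) x) (hc : Continuous f') :
    IsPrimitiveOn f f' a b := by
  refine ⟨hc.intervalIntegrable _ _, fun x _ => ?_⟩
  rw [intervalIntegral.integral_eq_sub_of_hasDerivAt (fun t _ => hf t) (hc.intervalIntegrable _ _)]
  ring

theorem mul (hab : a ≤ b) (hf : IsPrimitiveOn f f' a b) (hg : IsPrimitiveOn g g' a b) :
    IsPrimitiveOn (fun x => f x * g x) (fun x => f' x * g x + f x * g' x) a b := by
  refine of_absolutelyContinuous hab
    ((hf.absolutelyContinuous hab).smul (hg.absolutelyContinuous hab)) ?_ ?_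
  · have h1 := hf.continuousOn hab
    have h2 := hg.continuousOn hab
    rw [← uIcc_of_le hab] at h1 h2
    exact (hf.integrable.mul_continuousOn h2).add (hg.integrable.continuousOn_mul h1)
  · filter_upwards [hf.ae_hasDerivAt hab, hg.ae_hasDerivAt hab] with x h1 h2 hx
    exact (h1 hx).mul (h2 hx)

theorem add (hab : a ≤ b) (hf : IsPrimitiveOn f f' a b) (hg : IsPrimitiveOn g g' a b) :
    IsPrimitiveOn (fun x => f x + g x) (fun x => f' x + g' x) a b := by
  refine ⟨hf.integrable.add hg.integrable, fun x hx => ?_⟩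
  have hs : uIcc a x ⊆ uIcc a b := by
    rw [uIcc_of_le hab, uIcc_of_le hx.1]; exact Icc_subset_Icc_right hx.2
  rw [intervalIntegral.integral_add (hf.integrable.mono_set hs) (hg.integrable.mono_set hs),
    hf.eq_add_integral x hx, hg.eq_add_integral x hx]
  ring

theorem const_mul (c : ℂ) (hf : IsPrimitiveOn f f' a b) :
    IsPrimitiveOn (fun x => c * f x) (fun x => c * f' x) a b := by
  refine ⟨hf.integrable.const_mul c, fun x hx => ?_⟩
  rw [intervalIntegral.integral_const_mul, hf.eq_add_integral x hx]
  ring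

theorem sub (hab : a ≤ b) (hf : IsPrimitiveOn f f' a b) (hg : IsPrimitiveOn g g' a b) :
    IsPrimitiveOn (fun x => f x - g x) (fun x => f' x - g' x) a b := by
  simpa [sub_eq_add_neg] using hf.add hab (hg.const_mul (-1))

theorem star (hf : IsPrimitiveOn f f' a b) :
    IsPrimitiveOn (fun x => conj (f x)) (fun x => conj (f' x)) a b := by
  refine ⟨?_, fun x hx => ?_⟩
  · exact ⟨Complex.conjLIE.toContinuousLinearEquiv.toContinuousLinearMap.integrable_comp
      hf.integrable.1, Complex.conjLIE.toContinuousLinearEquiv.toContinuousLinearMap.integrable_comp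
      hf.integrable.2⟩
  · have hi : (∫ t in a..x, conj (f' t)) = conj (∫ t in a..x, f' t) := by
      rw [intervalIntegral.integral_of_le hx.1, intervalIntegral.integral_of_le hx.1, integral_conj]
    rw [hi, hf.eq_add_integral x hx, map_add]

theorem mono {c d : ℝ} (hab : a ≤ b) (hf : IsPrimitiveOn f f' a b) (hac : a ≤ c) (hcd : c ≤ d)
    (hdb : d ≤ b) : IsPrimitiveOn f f' c d := by
  have hs : ∀ {x y}, a ≤ x → x ≤ y → y ≤ b → IntervalIntegrable f' volume x y := by
    intro x y h1 h2 h3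
    refine hf.integrable.mono_set ?_
    rw [uIcc_of_le hab, uIcc_of_le h2]; exact Icc_subset_Icc h1 h3
  refine ⟨hs hac hcd hdb, fun x hx => ?_⟩
  rw [hf.eq_add_integral x ⟨hac.trans hx.1, hx.2.trans hdb⟩,
    hf.eq_add_integral c ⟨hac, hcd.trans hdb⟩, add_assoc,
    intervalIntegral.integral_add_adjacent_intervals (hs le_rfl hac (hcd.trans hdb))
      (hs hac hx.1 (hx.2.trans hdb))]

theorem sub_eq {c d : ℝ} (hab : a ≤ b) (hf : IsPrimitiveOn f f' a b) (hac : a ≤ c) (hcd : c ≤ d)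
    (hdb : d ≤ b) : f d - f c = ∫ t in c..d, f' t := by
  rw [(hf.mono hab hac hcd hdb).eq_add_integral d ⟨hcd, le_rfl⟩]; ring

theorem congr_ae (hab : a ≤ b) (hf : IsPrimitiveOn f f' a b)
    (h : ∀ᵐ x ∂volume.restrict (Icc a b), f' x = g' x) : IsPrimitiveOn f g' a b := by
  rw [ae_restrict_iff' measurableSet_Icc] at h
  have hs : ∀ x ∈ Icc a b, ∀ᵐ t, t ∈ uIoc a x → f' t = g' t := by
    intro x hx
    filter_upwards [h] with t ht hti
    rw [uIoc_of_le hx.1] at hti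
    exact ht ⟨hti.1.le, hti.2.trans hx.2⟩
  refine ⟨hf.integrable.congr_ae ?_, fun x hx => ?_⟩
  · rw [EventuallyEq, ae_restrict_iff' measurableSet_uIoc]
    exact hs b ⟨hab, le_rfl⟩
  · rw [hf.eq_add_integral x hx, intervalIntegral.integral_congr_ae (hs x hx)]

theorem congr (hf : IsPrimitiveOn f f' a b) (h : ∀ x, f' x = g' x) : IsPrimitiveOn f g' a b := by
  have : f' = g' := funext h
  rwa [← this]

theorem congr_left (hab : a ≤ b) (hf : IsPrimitiveOn f f' a b) (h : ∀ x ∈ Icc a b, g x = f x) :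
    IsPrimitiveOn g f' a b :=
  ⟨hf.integrable, fun x hx => by
    rw [h x hx, h a ⟨le_rfl, hab⟩]; exact hf.eq_add_integral x hx⟩

theorem congr_right (hf : IsPrimitiveOn f f' a b) (hab : a ≤ b) (h : ∀ x ∈ Icc a b, f' x = g' x) :
    IsPrimitiveOn f g' a b :=
  hf.congr_ae hab ((ae_restrict_iff' measurableSet_Icc).2 (Eventually.of_forall h))

theorem comp_add (s : ℝ) (hf : IsPrimitiveOn f f' (s + a) (s + b)) :
    IsPrimitiveOn (fun x => f (s + x)) (fun x => f' (s + x)) a b := by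
  refine ⟨?_, fun x hx => ?_⟩
  · simpa using hf.integrable.comp_add_left s
  · rw [intervalIntegral.integral_comp_add_left,
      hf.eq_add_integral (s + x) ⟨by linarith [hx.1], by linarith [hx.2]⟩]

theorem eq_of_deriv_zero (hf : IsPrimitiveOn f (fun _ => 0) a b) {x : ℝ} (hx : x ∈ Icc a b) :
    f x = f a := by simpa using hf.eq_add_integral x hx

end IsPrimitiveOn

/-! ### Solutions in integrated form -/

/-- `u` solves `-u'' + q u = z u` on `[a, b]`, with derivative `u'`, in integrated form. -/
structure SolvesOn (q : ℝ → ℝ) (z : ℂ) (a b : ℝ) (u u' : ℝ → ℂ) : Prop where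
  left : IsPrimitiveOn u u' a b
  right : IsPrimitiveOn u' (fun x => ((q x : ℂ) - z) * u x) a b

namespace SolvesOn

variable {q q₁ q₂ : ℝ → ℝ} {z z₁ z₂ : ℂ} {a b : ℝ} {u u' v v' : ℝ → ℂ}

theorem mono {c d : ℝ} (hab : a ≤ b) (h : SolvesOn q z a b u u') (hac : a ≤ c) (hcd : c ≤ d)
    (hdb : d ≤ b) : SolvesOn q z c d u u' :=
  ⟨h.left.mono hab hac hcd hdb, h.right.mono hab hac hcd hdb⟩

theorem comp_add (s : ℝ) (h : SolvesOn q z (s + a) (s + b) u u') :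
    SolvesOn (fun x => q (s + x)) z a b (fun x => u (s + x)) (fun x => u' (s + x)) :=
  ⟨h.left.comp_add s, h.right.comp_add s⟩

theorem congr_potential (hab : a ≤ b) (h : SolvesOn q₁ z a b u u')
    (hq : ∀ᵐ x ∂volume.restrict (Icc a b), q₁ x = q₂ x) : SolvesOn q₂ z a b u u' :=
  ⟨h.left, h.right.congr_ae hab (by filter_upwards [hq] with x hx; rw [hx])⟩

theorem congr (hab : a ≤ b) (h : SolvesOn q z a b u u') (hu : ∀ x ∈ Icc a b, v x = u x)
    (hu' : ∀ x ∈ Icc a b, v' x = u' x) : SolvesOn q z a b v v' := by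
  refine ⟨(h.left.congr_left hab hu).congr_right hab fun x hx => (hu' x hx).symm,
    (h.right.congr_left hab hu').congr_right hab fun x hx => ?_⟩
  rw [hu x hx]

theorem add (hab : a ≤ b) (h : SolvesOn q z a b u u') (k : SolvesOn q z a b v v') :
    SolvesOn q z a b (fun x => u x + v x) (fun x => u' x + v' x) :=
  ⟨h.left.add hab k.left, (h.right.add hab k.right).congr fun x => by ring⟩

theorem const_mul (c : ℂ) (h : SolvesOn q z a b u u') :
    SolvesOn q z a b (fun x => c * u x) (fun x => c * u' x) :=
  ⟨h.left.const_mul c, (h.right.const_mul c).congr fun x => by ring⟩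

theorem star (h : SolvesOn q z a b u u') :
    SolvesOn q (conj z) a b (fun x => conj (u x)) (fun x => conj (u' x)) :=
  ⟨h.left.star, h.right.star.congr fun x => by simp⟩

/-- The derivative of the Wronskian. -/
theorem wronskian (hab : a ≤ b) (h : SolvesOn q₁ z₁ a b u u') (k : SolvesOn q₂ z₂ a b v v') :
    IsPrimitiveOn (fun x => u x * v' x - u' x * v x)
      (fun x => (((q₂ x : ℂ) - z₂) - ((q₁ x : ℂ) - z₁)) * (u x * v x)) a b :=
  ((h.left.mul hab k.right).sub hab (h.right.mul hab k.left)).congr fun x => by ring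

theorem wronskian_const (hab : a ≤ b) (h : SolvesOn q z a b u u') (k : SolvesOn q z a b v v')
    {x : ℝ} (hx : x ∈ Icc a b) : u x * v' x - u' x * v x = u a * v' a - u' a * v a :=
  ((h.wronskian hab k).congr (g' := fun _ => 0) fun x => by ring).eq_of_deriv_zero hx

theorem continuousOn (hab : a ≤ b) (h : SolvesOn q z a b u u') : ContinuousOn u (Icc a b) :=
  h.left.continuousOn hab

theorem continuousOn' (hab : a ≤ b) (h : SolvesOn q z a b u u') : ContinuousOn u' (Icc a b) :=
  h.right.continuousOn hab

theorem intervalIntegrable_sq {x y : ℝ} (hab : a ≤ b) (h : SolvesOn q z a b u u') (hx : a ≤ x)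
    (hxy : x ≤ y) (hy : y ≤ b) : IntervalIntegrable (fun t => ‖u t‖ ^ 2) volume x y := by
  refine ContinuousOn.intervalIntegrable ?_
  rw [uIcc_of_le hxy]
  exact ((h.continuousOn hab).mono (Icc_subset_Icc hx hy)).norm.pow 2

/-- The imaginary part of the Green identity. -/
theorem im_sub_im {x y : ℝ} (hab : a ≤ b) (h : SolvesOn q z a b u u') (hx : a ≤ x)
    (hxy : x ≤ y) (hy : y ≤ b) :
    (conj (u y) * u' y).im - (conj (u x) * u' x).im = -z.im * ∫ t in x..y, ‖u t‖ ^ 2 := by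
  have H := (h.star.wronskian hab h).sub_eq hab hx hxy hy
  have e : ∀ t, conj (u t) * u' t - conj (u' t) * u t
      = ((2 * (conj (u t) * u' t).im : ℝ) : ℂ) * Complex.I := by
    intro t
    apply Complex.ext <;> simp <;> ring
  have e2 : ∀ t : ℝ, (((q t : ℂ) - z) - ((q t : ℂ) - conj z)) * (conj (u t) * u t)
      = (-2 * z.im * Complex.I) * ((‖u t‖ ^ 2 : ℝ) : ℂ) := by
    intro t
    rw [Complex.conj_mul']
    have : z - conj z = 2 * z.im * Complex.I := by
      apply Complex.ext <;> simp; ring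
    push_cast
    linear_combination (-((‖u t‖ : ℂ) ^ 2)) * this
  simp only [e, e2] at H
  rw [intervalIntegral.integral_const_mul, intervalIntegral.integral_ofReal] at H
  have := congrArg Complex.im H
  simp at this
  simp
  linarith

theorem eq_zero (hab : a ≤ b) (h : SolvesOn q z a b u u') {θ θ' φ φ' : ℝ → ℂ}
    (hθ : SolvesOn q z a b θ θ') (hφ : SolvesOn q z a b φ φ')
    (hW : θ a * φ' a - θ' a * φ a = 1) (h0 : u a = 0) (h0' : u' a = 0) {x : ℝ}
    (hx : x ∈ Icc a b) : u x = 0 ∧ u' x = 0 := by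
  have e1 := h.wronskian_const hab hθ hx
  have e2 := h.wronskian_const hab hφ hx
  have e3 := hθ.wronskian_const hab hφ hx
  rw [hW] at e3
  rw [h0, h0'] at e1 e2
  constructor
  · linear_combination (-u x) * e3 + (-φ x) * e1 + θ x * e2
  · linear_combination (-u' x) * e3 + (-φ' x) * e1 + θ' x * e2

end SolvesOn

/-- The kernel of the Volterra equation with exponential weight. -/
def volterraKernel (l t : ℝ) : ℝ := max t 0 * Real.exp (-(l * max t 0))

theorem continuous_volterraKernel (l : ℝ) : Continuous (volterraKernel l) := by
  unfold volterraKernel; fun_prop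

theorem volterraKernel_nonneg (l t : ℝ) : 0 ≤ volterraKernel l t :=
  mul_nonneg (le_max_right _ _) (Real.exp_pos _).le

theorem volterraKernel_le {l : ℝ} (hl : 0 < l) (t : ℝ) : volterraKernel l t ≤ 1 / l := by
  unfold volterraKernel
  have h := Real.add_one_le_exp (l * max t 0)
  rw [Real.exp_neg, ← div_eq_mul_inv, div_le_div_iff₀ (Real.exp_pos _) hl]
  linarith

/-- The inhomogeneous term of the Volterra equation, made bounded. -/
def volterraData (l c : ℝ) (A B : ℂ) (x : ℝ) : ℂ :=
  Real.exp (-(l * min (max x 0) c)) * (A + B * (min (max x 0) c : ℝ))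

theorem exists_volterra_solution {Q : ℝ → ℂ} (hQ : Integrable Q) (c : ℝ) (A B : ℂ) :
    ∃ l : ℝ, ∃ v : ℝ → ℂ, Continuous v ∧ ∀ x,
      v x = volterraData l c A B x + ∫ y, (volterraKernel l (x - y) : ℂ) * (Q y * v y) := by
  set N := ∫ y, ‖Q y‖ with hN
  have hN0 : 0 ≤ N := integral_nonneg fun _ => norm_nonneg _
  set l := 2 * N + 1 with hl
  have hl0 : 0 < l := by linarith
  have hker : ∀ x y, ‖(volterraKernel l (x - y) : ℂ)‖ ≤ 1 / l := fun x y => by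
    rw [Complex.norm_real, Real.norm_of_nonneg (volterraKernel_nonneg _ _)]
    exact volterraKernel_le hl0 _
  have hbd : ∀ (w : BoundedContinuousFunction ℝ ℂ) x y,
      ‖(volterraKernel l (x - y) : ℂ) * (Q y * w y)‖ ≤ 1 / l * (‖Q y‖ * ‖w‖) := by
    intro w x y
    rw [norm_mul, norm_mul]
    gcongr
    · exact hker x y
    · exact w.norm_coe_le_norm y
  have hmeas : ∀ (w : BoundedContinuousFunction ℝ ℂ) x, AEStronglyMeasurable
      (fun y => (volterraKernel l (x - y) : ℂ) * (Q y * w y)) := by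
    intro w x
    refine AEStronglyMeasurable.mul ?_ (hQ.1.mul w.continuous.aestronglyMeasurable)
    have := continuous_volterraKernel l
    exact (by fun_prop : Continuous fun y => (volterraKernel l (x - y) : ℂ)).aestronglyMeasurable
  have hdom : ∀ w : BoundedContinuousFunction ℝ ℂ,
      Integrable (fun y => 1 / l * (‖Q y‖ * ‖w‖)) := fun w => (hQ.norm.mul_const _).const_mul _
  have hI : ∀ (w : BoundedContinuousFunction ℝ ℂ) x,
      Integrable (fun y => (volterraKernel l (x - y) : ℂ) * (Q y * w y)) := fun w x =>
    (hdom w).mono' (hmeas w x) (Eventually.of_forall (hbd w x))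
  have hcont : ∀ w : BoundedContinuousFunction ℝ ℂ, Continuous
      fun x => ∫ y, (volterraKernel l (x - y) : ℂ) * (Q y * w y) := by
    intro w
    refine continuous_of_dominated (hmeas w) (fun x => Eventually.of_forall (hbd w x)) (hdom w) ?_
    refine Eventually.of_forall fun y => ?_
    have := continuous_volterraKernel l
    fun_prop
  have hdc : Continuous (volterraData l c A B) := by
    unfold volterraData; fun_prop
  have hdb : ∃ M, ∀ x, ‖volterraData l c A B x‖ ≤ M := by
    have hg : Continuous fun p : ℝ => (Real.exp (-(l * p)) : ℂ) * (A + B * (p : ℂ)) := by fun_prop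
    obtain ⟨M, hM⟩ := (isCompact_Icc (a := min 0 c) (b := c)).exists_bound_of_continuousOn
      hg.continuousOn
    refine ⟨M, fun x => ?_⟩
    simpa [volterraData] using hM (min (max x 0) c) ⟨min_le_min (le_max_right _ _) le_rfl,
      min_le_right _ _⟩
  obtain ⟨M, hM⟩ := hdb
  let T : BoundedContinuousFunction ℝ ℂ → BoundedContinuousFunction ℝ ℂ := fun w =>
    BoundedContinuousFunction.ofNormedAddCommGroup
      (fun x => volterraData l c A B x + ∫ y, (volterraKernel l (x - y) : ℂ) * (Q y * w y))
      (hdc.add (hcont w)) (M + ∫ y, 1 / l * (‖Q y‖ * ‖w‖)) (fun x => by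
        refine (norm_add_le _ _).trans (add_le_add (hM x) ?_)
        exact norm_integral_le_of_norm_le (hdom w) (Eventually.of_forall (hbd w x)))
  have hT : ContractingWith (1 / 2) T := by
    refine ⟨by norm_num, LipschitzWith.of_dist_le_mul fun w₁ w₂ => ?_⟩
    rw [BoundedContinuousFunction.dist_le (by positivity)]
    intro x
    have e : T w₁ x - T w₂ x = ∫ y, (volterraKernel l (x - y) : ℂ) * (Q y * (w₁ - w₂) y) := by
      simp only [T, BoundedContinuousFunction.coe_ofNormedAddCommGroup, add_sub_add_left_eq_sub]
      rw [← integral_sub (hI w₁ x) (hI w₂ x)]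
      congr 1; ext y
      simp only [BoundedContinuousFunction.coe_sub, Pi.sub_apply]; ring
    rw [dist_eq_norm, e, dist_eq_norm]
    refine (norm_integral_le_of_norm_le (hdom _) (Eventually.of_forall (hbd _ x))).trans ?_
    rw [integral_const_mul, integral_mul_const, ← hN, ← mul_assoc]
    have : 1 / l * N ≤ 1 / 2 := by
      rw [one_div, inv_mul_le_iff₀ hl0]; linarith
    have h2 : (((1 / 2 : NNReal)) : ℝ) = 1 / 2 := by norm_num
    rw [h2]
    gcongr
  obtain ⟨w, hw⟩ : ∃ w, T w = w := ⟨_, hT.fixedPoint_isFixedPt⟩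
  refine ⟨l, w, w.continuous, fun x => ?_⟩
  exact (congrArg (fun w : BoundedContinuousFunction ℝ ℂ => w x) hw).symm

theorem exists_solvesOn_of_integrable {Q : ℝ → ℂ} (hQ : Integrable Q) {c : ℝ} (hc : 0 ≤ c)
    (A B : ℂ) : ∃ u u' : ℝ → ℂ, u 0 = A ∧ u' 0 = B ∧ IsPrimitiveOn u u' 0 c ∧
      IsPrimitiveOn u' (fun x => Q x * u x) 0 c := by
  obtain ⟨l, v, hv, hveq⟩ := exists_volterra_solution
    (hQ.indicator (measurableSet_Ioi (a := (0 : ℝ)))) c A B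
  set u : ℝ → ℂ := fun x => Real.exp (l * x) * v x with hu
  have hucont : Continuous u := by fun_prop
  have hQu : ∀ x, IntervalIntegrable (fun y => Q y * u y) volume 0 x := fun x =>
    hQ.intervalIntegrable.mul_continuousOn hucont.continuousOn
  have hyQu : ∀ x, IntervalIntegrable (fun y => (y : ℂ) * (Q y * u y)) volume 0 x := fun x =>
    (hQu x).continuousOn_mul Complex.continuous_ofReal.continuousOn
  have key : ∀ x ∈ Icc 0 c, u x = A + B * x + ∫ y in 0..x, ((x : ℂ) - y) * (Q y * u y) := by
    intro x hx
    have hcl : min (max x 0) c = x := by rw [max_eq_left hx.1, min_eq_left hx.2]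
    have hexp : (Real.exp (l * x) : ℂ) * (Real.exp (-(l * x)) : ℂ) = 1 := by
      rw [← Complex.ofReal_mul, ← Real.exp_add]; simp
    simp only [hu]
    rw [hveq x, mul_add, volterraData, hcl, ← mul_assoc, hexp, one_mul,
      intervalIntegral.integral_of_le hx.1, ← integral_const_mul,
      ← integral_indicator measurableSet_Ioc]
    congr 2
    ext y
    by_cases hy0 : 0 < y
    · by_cases hyx : y ≤ x
      · rw [indicator_of_mem (show y ∈ Ioi (0 : ℝ) from hy0),
          indicator_of_mem (show y ∈ Ioc 0 x from ⟨hy0, hyx⟩), volterraKernel,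
          max_eq_left (sub_nonneg.2 hyx)]
        have : Real.exp (l * x) * Real.exp (-(l * (x - y))) = Real.exp (l * y) := by
          rw [← Real.exp_add]; congr 1; ring
        rw [← this]
        push_cast; ring
      · rw [indicator_of_notMem (show y ∉ Ioc 0 x from fun h => hyx h.2), volterraKernel,
          max_eq_right (by linarith)]
        simp
    · rw [indicator_of_notMem (show y ∉ Ioi (0 : ℝ) from hy0),
        indicator_of_notMem (show y ∉ Ioc 0 x from fun h => hy0 h.1)]
      simp
  have hJ : IsPrimitiveOn (fun x => ∫ y in 0..x, Q y * u y) (fun x => Q x * u x) 0 c :=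
    ⟨hQu c, fun x _ => by simp⟩
  have hL : IsPrimitiveOn (fun x => ∫ y in 0..x, (y : ℂ) * (Q y * u y))
      (fun x => (x : ℂ) * (Q x * u x)) 0 c := ⟨hyQu c, fun x _ => by simp⟩
  have hid : IsPrimitiveOn (fun x : ℝ => (x : ℂ)) (fun _ => 1) 0 c :=
    IsPrimitiveOn.of_hasDerivAt (fun x => (hasDerivAt_id x).ofReal_comp) continuous_const
  have hconst : ∀ D : ℂ, IsPrimitiveOn (fun _ : ℝ => D) (fun _ => 0) 0 c := fun D =>
    IsPrimitiveOn.of_hasDerivAt (fun x => hasDerivAt_const x D) continuous_const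
  refine ⟨u, fun x => B + ∫ y in 0..x, Q y * u y, ?_, by simp, ?_, ?_⟩
  · simpa using key 0 ⟨le_rfl, hc⟩
  · have := ((hconst A).add hc (hid.const_mul B)).add hc ((hid.mul hc hJ).sub hc hL)
    refine (this.congr fun x => by ring).congr_left hc fun x hx => ?_
    rw [key x hx, ← intervalIntegral.integral_const_mul,
      ← intervalIntegral.integral_sub ((hQu x).const_mul _) (hyQu x)]
    congr 2
    ext y; ring
  · exact ((hconst B).add hc hJ).congr fun x => by ring

theorem exists_solvesOn {q : ℝ → ℝ} {c : ℝ} (hc : 0 ≤ c) (hq : IntegrableOn q (Ioo 0 c))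
    (z A B : ℂ) : ∃ u u' : ℝ → ℂ, u 0 = A ∧ u' 0 = B ∧ SolvesOn q z 0 c u u' := by
  have hI : IntegrableOn (fun x => (q x : ℂ) - z) (Ioo 0 c) :=
    hq.ofReal.sub (integrableOn_const (by simp))
  obtain ⟨u, u', h0, h0', h1, h2⟩ := exists_solvesOn_of_integrable
    (hI.integrable_indicator measurableSet_Ioo) hc A B
  refine ⟨u, u', h0, h0', h1, h2.congr_ae hc ?_⟩
  rw [Measure.restrict_congr_set Ioo_ae_eq_Icc.symm, ae_restrict_iff' measurableSet_Ioo]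
  refine Eventually.of_forall fun x hx => ?_
  simp only [indicator_of_mem hx]

/-- Solutions with prescribed Cauchy data at the right endpoint. -/
theorem exists_solvesOn_final {q : ℝ → ℝ} {c : ℝ} (hc : 0 ≤ c) (hq : IntegrableOn q (Ioo 0 c))
    (z A B : ℂ) : ∃ u u' : ℝ → ℂ, u c = A ∧ u' c = B ∧ SolvesOn q z 0 c u u' := by
  obtain ⟨θ, θ', a1, a2, hθ⟩ := exists_solvesOn hc hq z 1 0
  obtain ⟨φ, φ', b1, b2, hφ⟩ := exists_solvesOn hc hq z 0 1
  have hW := hθ.wronskian_const hc hφ ⟨hc, le_rfl⟩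
  rw [a1, a2, b1, b2] at hW
  refine ⟨_, _, ?_, ?_, (hθ.const_mul (A * φ' c - B * φ c)).add hc
    (hφ.const_mul (B * θ c - A * θ' c))⟩
  · linear_combination A * hW
  · linear_combination B * hW

theorem SolvesOn.eq_of_initial {q : ℝ → ℝ} {c : ℝ} {z : ℂ} {u u' v v' : ℝ → ℂ} (hc : 0 ≤ c)
    (hq : IntegrableOn q (Ioo 0 c)) (hu : SolvesOn q z 0 c u u') (hv : SolvesOn q z 0 c v v')
    (h0 : u 0 = v 0) (h0' : u' 0 = v' 0) {x : ℝ} (hx : x ∈ Icc 0 c) : u x = v x ∧ u' x = v' x := by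
  obtain ⟨θ, θ', a1, a2, hθ⟩ := exists_solvesOn hc hq z 1 0
  obtain ⟨φ, φ', b1, b2, hφ⟩ := exists_solvesOn hc hq z 0 1
  have := (hu.add hc (hv.const_mul (-1))).eq_zero hc hθ hφ (by simp [a1, a2, b1, b2])
    (by simp [h0]) (by simp [h0']) hx
  constructor
  · linear_combination this.1
  · linear_combination this.2

/-- Solutions on the half-line with prescribed initial data. -/
theorem exists_solvesOn_halfLine {q : ℝ → ℝ} (hq : LocallyIntegrableHalfLine q) (z A B : ℂ) :
    ∃ u u' : ℝ → ℂ, u 0 = A ∧ u' 0 = B ∧ ∀ c, 0 ≤ c → SolvesOn q z 0 c u u' := by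
  have hpos : ∀ n : ℕ, (0 : ℝ) < n + 1 := fun n => by positivity
  choose u u' h0 h0' hs using fun n : ℕ => exists_solvesOn (hpos n).le (hq _ (hpos n)) z A B
  refine ⟨fun x => u ⌊x⌋₊ x, fun x => u' ⌊x⌋₊ x, by simp [h0], by simp [h0'], fun c hc => ?_⟩
  have hcN : c ≤ (⌊c⌋₊ : ℝ) + 1 := (Nat.lt_floor_add_one c).le
  have hagree : ∀ x ∈ Icc 0 c, u ⌊x⌋₊ x = u ⌊c⌋₊ x ∧ u' ⌊x⌋₊ x = u' ⌊c⌋₊ x := by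
    intro x hx
    have hle : ((⌊x⌋₊ : ℝ) + 1) ≤ (⌊c⌋₊ : ℝ) + 1 := by
      gcongr; exact hx.2
    exact SolvesOn.eq_of_initial (hpos ⌊x⌋₊).le (hq _ (hpos ⌊x⌋₊)) (hs _)
      ((hs ⌊c⌋₊).mono (hpos _).le le_rfl (hpos _).le hle) (by rw [h0, h0]) (by rw [h0', h0'])
      ⟨hx.1, (Nat.lt_floor_add_one x).le⟩
  exact ((hs ⌊c⌋₊).mono (hpos _).le le_rfl hc hcN).congr hc (fun x hx => (hagree x hx).1)
    (fun x hx => (hagree x hx).2)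

/-! ### The Weyl disc of an interval of length `δ` -/

theorem norm_cexp_mul_ofReal (κ : ℂ) (x : ℝ) : ‖Complex.exp (κ * x)‖ = Real.exp (κ.re * x) := by
  rw [Complex.norm_exp]; simp

theorem isPrimitiveOn_cexp (κ : ℂ) (a b : ℝ) :
    IsPrimitiveOn (fun x => Complex.exp (κ * x)) (fun x => κ * Complex.exp (κ * x)) a b := by
  refine IsPrimitiveOn.of_hasDerivAt (fun x => ?_) (by fun_prop)
  have h := ((hasDerivAt_id x).ofReal_comp.const_mul κ).cexp
  simpa [mul_comm] using h

/-- Variation of parameters. -/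
theorem SolvesOn.exp_mul {q : ℝ → ℝ} {κ : ℂ} {a b : ℝ} {u u' : ℝ → ℂ} (hab : a ≤ b)
    (h : SolvesOn q (-κ ^ 2) a b u u') :
    IsPrimitiveOn (fun x => Complex.exp (-κ * x) * (u' x + κ * u x))
      (fun x => Complex.exp (-κ * x) * (q x * u x)) a b :=
  ((isPrimitiveOn_cexp (-κ) a b).mul hab (h.right.add hab (h.left.const_mul κ))).congr
    fun x => by ring

theorem SolvesOn.exp_mul' {q : ℝ → ℝ} {κ : ℂ} {a b : ℝ} {u u' : ℝ → ℂ} (hab : a ≤ b)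
    (h : SolvesOn q (-κ ^ 2) a b u u') :
    IsPrimitiveOn (fun x => Complex.exp (κ * x) * (u' x - κ * u x))
      (fun x => Complex.exp (κ * x) * (q x * u x)) a b := by
  have h' : SolvesOn q (-(-κ) ^ 2) a b u u' := by rwa [neg_sq]
  simpa [sub_eq_add_neg] using h'.exp_mul hab

theorem intervalIntegrable_of_Ioo {q : ℝ → ℝ} {a b : ℝ} (hab : a ≤ b)
    (hq : IntegrableOn q (Ioo a b)) : IntervalIntegrable q volume a b := by
  rw [intervalIntegrable_iff_integrableOn_Ioo_of_le hab]; exact hq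

theorem norm_integral_le_mul {q : ℝ → ℝ} {g : ℝ → ℂ} {a b c d N : ℝ}
    (hq : IntervalIntegrable q volume a b) (hac : a ≤ c) (hcd : c ≤ d) (hdb : d ≤ b)
    (hN : 0 ≤ N) (h : ∀ y ∈ Icc c d, ‖g y‖ ≤ N * |q y|) :
    ‖∫ y in c..d, g y‖ ≤ N * ∫ y in a..b, |q y| := by
  have hab : a ≤ b := hac.trans (hcd.trans hdb)
  have hs : uIcc c d ⊆ uIcc a b := by
    rw [uIcc_of_le hab, uIcc_of_le hcd]; exact Icc_subset_Icc hac hdb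
  refine (intervalIntegral.norm_integral_le_of_norm_le hcd (g := fun y => N * |q y|)
    (Eventually.of_forall fun y hy => h y ⟨hy.1.le, hy.2⟩)
    ((hq.abs.mono_set hs).const_mul N)).trans ?_
  rw [intervalIntegral.integral_const_mul]
  refine mul_le_mul_of_nonneg_left ?_ hN
  exact intervalIntegral.integral_mono_interval hac hcd hdb
    (Eventually.of_forall fun y => abs_nonneg _) hq.abs

section

variable {q : ℝ → ℝ} {κ : ℂ} {δ : ℝ} {φ φ' f f' : ℝ → ℂ}

/-- The solution with `φ(0) = 0`, `φ'(0) = 1` is close to `sinh(κ x) / κ`. -/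
theorem sine_solution_bounds (hδ : 0 ≤ δ) (hq : IntervalIntegrable q volume 0 δ)
    (hk : 0 < κ.re) (hη : ∫ y in 0..δ, |q y| ≤ ‖κ‖ / 4)
    (hφ : SolvesOn q (-κ ^ 2) 0 δ φ φ') (h0 : φ 0 = 0) (h0' : φ' 0 = 1) {x : ℝ}
    (hx : x ∈ Icc 0 δ) :
    2 / 3 * Real.exp (κ.re * x) ≤ ‖φ' x + κ * φ x‖ ∧
      Real.exp (κ.re * x) / 3 - Real.exp (-(κ.re * x)) ≤ 2 * ‖κ‖ * ‖φ x‖ := by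
  set I := ∫ y in 0..δ, |q y| with hI
  have hI0 : 0 ≤ I := intervalIntegral.integral_nonneg hδ fun _ _ => abs_nonneg _
  have hκ : 0 < ‖κ‖ := norm_pos_iff.2 fun h => by simp [h] at hk
  have hcont : ContinuousOn (fun y => Real.exp (-(κ.re * y)) * ‖φ y‖) (Icc 0 δ) :=
    (by fun_prop : Continuous fun y => Real.exp (-(κ.re * y))).continuousOn.mul
      (hφ.continuousOn hδ).norm
  obtain ⟨x₀, hx₀, hmax⟩ := isCompact_Icc.exists_isMaxOn ⟨0, le_rfl, hδ⟩ hcont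
  set N := Real.exp (-(κ.re * x₀)) * ‖φ x₀‖ with hN
  have hN0 : 0 ≤ N := by positivity
  have hNb : ∀ y ∈ Icc 0 δ, ‖φ y‖ ≤ Real.exp (κ.re * y) * N := by
    intro y hy
    have : Real.exp (-(κ.re * y)) * ‖φ y‖ ≤ N := hmax hy
    rw [Real.exp_neg, inv_mul_le_iff₀ (Real.exp_pos _)] at this
    exact this
  have hp : ∀ x ∈ Icc 0 δ, ‖Complex.exp (-κ * x) * (φ' x + κ * φ x) - 1‖ ≤ N * I := by
    intro x hx
    have e := (hφ.exp_mul hδ).sub_eq hδ le_rfl hx.1 hx.2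
    simp only [h0, h0', Complex.ofReal_zero, mul_zero, Complex.exp_zero, add_zero, mul_one] at e
    rw [e]
    refine norm_integral_le_mul hq le_rfl hx.1 hx.2 hN0 fun y hy => ?_
    rw [norm_mul, norm_mul, norm_cexp_mul_ofReal, Complex.norm_real, Real.norm_eq_abs]
    have := hNb y ⟨hy.1, hy.2.trans hx.2⟩
    calc Real.exp ((-κ).re * y) * (|q y| * ‖φ y‖)
        ≤ Real.exp ((-κ).re * y) * (|q y| * (Real.exp (κ.re * y) * N)) := by gcongr
      _ = (Real.exp ((-κ).re * y) * Real.exp (κ.re * y)) * (N * |q y|) := by ring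
      _ = N * |q y| := by rw [← Real.exp_add]; simp
  have hm : ∀ x ∈ Icc 0 δ, ‖Complex.exp (κ * x) * (φ' x - κ * φ x) - 1‖
      ≤ Real.exp (2 * κ.re * x) * N * I := by
    intro x hx
    have e := (hφ.exp_mul' hδ).sub_eq hδ le_rfl hx.1 hx.2
    simp only [h0, h0', Complex.ofReal_zero, mul_zero, Complex.exp_zero, sub_zero, mul_one] at e
    rw [e]
    refine norm_integral_le_mul hq le_rfl hx.1 hx.2 (by positivity) fun y hy => ?_
    rw [norm_mul, norm_mul, norm_cexp_mul_ofReal, Complex.norm_real, Real.norm_eq_abs]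
    have := hNb y ⟨hy.1, hy.2.trans hx.2⟩
    calc Real.exp (κ.re * y) * (|q y| * ‖φ y‖)
        ≤ Real.exp (κ.re * y) * (|q y| * (Real.exp (κ.re * y) * N)) := by gcongr
      _ = Real.exp (2 * κ.re * y) * N * |q y| := by
          rw [show 2 * κ.re * y = κ.re * y + κ.re * y by ring, Real.exp_add]; ring
      _ ≤ Real.exp (2 * κ.re * x) * N * |q y| := by gcongr; exact hy.2
  have hee : ∀ x : ℝ, Complex.exp (κ * x) * Complex.exp (-κ * x) = 1 := fun x => by
    rw [← Complex.exp_add]; simp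
  have hmain : ∀ x ∈ Icc 0 δ, ‖2 * κ * φ x - (Complex.exp (κ * x) - Complex.exp (-κ * x))‖
      ≤ 2 * Real.exp (κ.re * x) * (N * I) := by
    intro x hx
    have e : 2 * κ * φ x - (Complex.exp (κ * x) - Complex.exp (-κ * x))
        = Complex.exp (κ * x) * (Complex.exp (-κ * x) * (φ' x + κ * φ x) - 1)
          - Complex.exp (-κ * x) * (Complex.exp (κ * x) * (φ' x - κ * φ x) - 1) := by
      linear_combination (-2 * κ * φ x) * hee x
    rw [e]
    refine (norm_sub_le _ _).trans ?_
    rw [norm_mul, norm_mul, norm_cexp_mul_ofReal, norm_cexp_mul_ofReal]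
    have h1 : Real.exp ((-κ).re * x) * Real.exp (2 * κ.re * x) = Real.exp (κ.re * x) := by
      rw [← Real.exp_add]; congr 1; simp; ring
    calc _ ≤ Real.exp (κ.re * x) * (N * I)
          + Real.exp ((-κ).re * x) * (Real.exp (2 * κ.re * x) * N * I) := by
          gcongr
          · exact hp x hx
          · exact hm x hx
      _ = Real.exp (κ.re * x) * (N * I)
          + (Real.exp ((-κ).re * x) * Real.exp (2 * κ.re * x)) * (N * I) := by ring
      _ = _ := by rw [h1]; ring
  have hnn : ∀ x : ℝ, ‖2 * κ * φ x‖ = 2 * ‖κ‖ * ‖φ x‖ := fun x => by simp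
  have hneg : ∀ x : ℝ, ‖Complex.exp (-κ * x)‖ = Real.exp (-(κ.re * x)) := fun x => by
    rw [norm_cexp_mul_ofReal]; simp
  have hNκ : ‖κ‖ * N ≤ 4 / 3 := by
    have h1 := hmain x₀ hx₀
    have h2 : ‖2 * κ * φ x₀‖ ≤ ‖Complex.exp (κ * x₀)‖ + ‖Complex.exp (-κ * x₀)‖
        + 2 * Real.exp (κ.re * x₀) * (N * I) := by
      calc _ = ‖(2 * κ * φ x₀ - (Complex.exp (κ * x₀) - Complex.exp (-κ * x₀)))
            + (Complex.exp (κ * x₀) - Complex.exp (-κ * x₀))‖ := by congr 1; ring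
        _ ≤ _ := (norm_add_le _ _).trans (by
            have := norm_sub_le (Complex.exp (κ * x₀)) (Complex.exp (-κ * x₀)); linarith)
    rw [hnn, norm_cexp_mul_ofReal, hneg] at h2
    have h3 : Real.exp (-(κ.re * x₀)) ≤ Real.exp (κ.re * x₀) := by
      apply Real.exp_le_exp.2
      have := mul_nonneg hk.le hx₀.1
      linarith
    have h4 : ‖φ x₀‖ = Real.exp (κ.re * x₀) * N := by
      rw [hN, ← mul_assoc, ← Real.exp_add]; simp
    rw [h4] at h2
    have h5 : Real.exp (κ.re * x₀) * (‖κ‖ * N) ≤ Real.exp (κ.re * x₀) * (1 + N * I) := by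
      nlinarith
    have h6 := le_of_mul_le_mul_left h5 (Real.exp_pos _)
    nlinarith [mul_le_mul_of_nonneg_left hη hN0]
  have hNI : N * I ≤ 1 / 3 := by
    nlinarith [mul_le_mul_of_nonneg_left hη hN0]
  constructor
  · have h1 := (hp x hx).trans hNI
    have h2 : 1 - 1 / 3 ≤ ‖Complex.exp (-κ * x) * (φ' x + κ * φ x)‖ := by
      have := norm_sub_norm_le (1 : ℂ) (1 - Complex.exp (-κ * x) * (φ' x + κ * φ x))
      rw [norm_sub_rev 1 (Complex.exp (-κ * x) * (φ' x + κ * φ x)), sub_sub_cancel, norm_one]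
        at this
      linarith
    rw [norm_mul, hneg, Real.exp_neg, le_inv_mul_iff₀ (Real.exp_pos _)] at h2
    linarith
  · have h1 := hmain x hx
    have h2 := norm_sub_norm_le (Complex.exp (κ * x)) (Complex.exp (-κ * x))
    have h3 := norm_sub_norm_le (Complex.exp (κ * x) - Complex.exp (-κ * x)) (2 * κ * φ x)
    rw [norm_sub_rev (Complex.exp (κ * x) - Complex.exp (-κ * x)), hnn] at h3
    rw [hneg, norm_cexp_mul_ofReal] at h2
    nlinarith [Real.exp_pos (κ.re * x)]

/-- The solution that continues as `exp (-κ x)` to the right of `δ`. -/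
theorem jost_solution_bounds (hδ : 0 ≤ δ) (hq : IntervalIntegrable q volume 0 δ)
    (hk : 0 < κ.re) (hη : ∫ y in 0..δ, |q y| ≤ ‖κ‖ / 4)
    (hf : SolvesOn q (-κ ^ 2) 0 δ f f') (h0 : f δ = Complex.exp (-κ * δ))
    (h0' : f' δ = -κ * Complex.exp (-κ * δ)) :
    2 / 3 ≤ ‖f 0‖ ∧
      ‖f' 0 + κ * f 0‖ ≤ 4 / 3 * ∫ y in 0..δ, Real.exp (-2 * κ.re * y) * |q y| := by
  set I := ∫ y in 0..δ, |q y| with hI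
  have hI0 : 0 ≤ I := intervalIntegral.integral_nonneg hδ fun _ _ => abs_nonneg _
  have hκ : 0 < ‖κ‖ := norm_pos_iff.2 fun h => by simp [h] at hk
  set g : ℝ → ℂ := fun x => Complex.exp (κ * x) * f x with hg
  have hcont : ContinuousOn (fun y => ‖g y‖) (Icc 0 δ) :=
    ((by fun_prop : Continuous fun y : ℝ => Complex.exp (κ * y)).continuousOn.mul
      (hf.continuousOn hδ)).norm
  obtain ⟨x₀, hx₀, hmax⟩ := isCompact_Icc.exists_isMaxOn ⟨0, le_rfl, hδ⟩ hcont
  set M := ‖g x₀‖ with hM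
  have hM0 : 0 ≤ M := norm_nonneg _
  have hMb : ∀ y ∈ Icc 0 δ, ‖g y‖ ≤ M := fun y hy => hmax hy
  have hee : ∀ x : ℝ, Complex.exp (κ * x) * Complex.exp (-κ * x) = 1 := fun x => by
    rw [← Complex.exp_add]; simp
  have hnorm : ∀ y : ℝ, ‖Complex.exp (-κ * y) * (q y * f y)‖
      = ‖g y‖ * (Real.exp (-2 * κ.re * y) * |q y|) := by
    intro y
    have : Complex.exp (-κ * y) * (q y * f y)
        = Complex.exp (-2 * κ * y) * (q y * g y) := by
      have h2 : Complex.exp (-κ * y) = Complex.exp (-2 * κ * y) * Complex.exp (κ * y) := by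
        rw [← Complex.exp_add]; congr 1; ring
      rw [h2, hg]; ring
    rw [this, norm_mul, norm_mul, norm_cexp_mul_ofReal, Complex.norm_real, Real.norm_eq_abs]
    have : (-2 * κ).re = -2 * κ.re := by simp
    rw [this]; ring
  have hp : ∀ x ∈ Icc 0 δ, Complex.exp (-κ * x) * (f' x + κ * f x)
      = -∫ y in x..δ, Complex.exp (-κ * y) * (q y * f y) := by
    intro x hx
    have e := (hf.exp_mul hδ).sub_eq hδ hx.1 hx.2 le_rfl
    rw [h0, h0'] at e
    linear_combination -e
  have hpn : ∀ x ∈ Icc 0 δ,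
      ‖Complex.exp (κ * x) * Complex.exp (κ * x) * (Complex.exp (-κ * x) * (f' x + κ * f x))‖
        ≤ M * I := by
    intro x hx
    rw [hp x hx, norm_mul, norm_neg, ← Complex.exp_add, ← mul_add]
    have h1 : ‖∫ y in x..δ, Complex.exp (-κ * y) * (q y * f y)‖
        ≤ (M * Real.exp (-2 * κ.re * x)) * I := by
      refine norm_integral_le_mul hq hx.1 hx.2 le_rfl (by positivity) fun y hy => ?_
      rw [hnorm]
      have h1 := hMb y ⟨hx.1.trans hy.1, hy.2⟩
      have h2 : Real.exp (-2 * κ.re * y) ≤ Real.exp (-2 * κ.re * x) := by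
        apply Real.exp_le_exp.2; nlinarith [hy.1]
      rw [mul_assoc M]
      gcongr
    have h2 : ‖Complex.exp (κ * (x + x))‖ = Real.exp (2 * κ.re * x) := by
      rw [Complex.norm_exp]; congr 1; simp; ring
    rw [h2]
    calc _ ≤ Real.exp (2 * κ.re * x) * ((M * Real.exp (-2 * κ.re * x)) * I) := by gcongr
      _ = (Real.exp (2 * κ.re * x) * Real.exp (-2 * κ.re * x)) * (M * I) := by ring
      _ = M * I := by rw [← Real.exp_add]; simp
  have hmn : ∀ x ∈ Icc 0 δ, ‖-2 * κ - Complex.exp (κ * x) * (f' x - κ * f x)‖ ≤ M * I := by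
    intro x hx
    have e := (hf.exp_mul' hδ).sub_eq hδ hx.1 hx.2 le_rfl
    rw [h0, h0'] at e
    have e2 : -2 * κ - Complex.exp (κ * x) * (f' x - κ * f x)
        = ∫ y in x..δ, Complex.exp (κ * y) * (q y * f y) := by
      linear_combination e + (2 * κ) * hee δ
    rw [e2]
    refine norm_integral_le_mul hq hx.1 hx.2 le_rfl hM0 fun y hy => ?_
    have h1 := hMb y ⟨hx.1.trans hy.1, hy.2⟩
    have : Complex.exp (κ * y) * (q y * f y) = g y * q y := by rw [hg]; ring
    rw [this, norm_mul, Complex.norm_real, Real.norm_eq_abs]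
    gcongr
  have hgm : ∀ x ∈ Icc 0 δ, ‖g x - 1‖ ≤ M / 4 := by
    intro x hx
    have e : 2 * κ * (g x - 1)
        = Complex.exp (κ * x) * Complex.exp (κ * x) * (Complex.exp (-κ * x) * (f' x + κ * f x))
          + (-2 * κ - Complex.exp (κ * x) * (f' x - κ * f x)) := by
      rw [hg]
      linear_combination (-(Complex.exp (κ * x) * (f' x + κ * f x))) * hee x
    have h1 : ‖2 * κ * (g x - 1)‖ ≤ M * I + M * I := by
      rw [e]; exact (norm_add_le _ _).trans (add_le_add (hpn x hx) (hmn x hx))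
    have h2 : ‖2 * κ * (g x - 1)‖ = 2 * ‖κ‖ * ‖g x - 1‖ := by simp
    rw [h2] at h1
    have h3 := mul_le_mul_of_nonneg_left hη hM0
    have h4 : ‖κ‖ * ‖g x - 1‖ ≤ ‖κ‖ * (M / 4) := by linarith
    exact le_of_mul_le_mul_left h4 hκ
  have hM43 : M ≤ 4 / 3 := by
    have h1 := hgm x₀ hx₀
    have h2 := norm_sub_norm_le (g x₀) 1
    rw [norm_one] at h2
    linarith
  have hz : (0 : ℝ) ∈ Icc 0 δ := ⟨le_rfl, hδ⟩
  constructor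
  · have h1 := hgm 0 hz
    have h2 := norm_sub_norm_le 1 (1 - g 0)
    rw [norm_sub_rev 1 (g 0), sub_sub_cancel, norm_one] at h2
    have : g 0 = f 0 := by simp [hg]
    rw [this] at h1 h2
    linarith
  · have e := hp 0 hz
    simp only [Complex.ofReal_zero, mul_zero, Complex.exp_zero, one_mul] at e
    rw [e, norm_neg, ← intervalIntegral.integral_const_mul]
    refine intervalIntegral.norm_integral_le_of_norm_le hδ (Eventually.of_forall fun y hy => ?_)
      ((hq.abs.continuousOn_mul
        (by fun_prop : Continuous fun y => Real.exp (-2 * κ.re * y)).continuousOn).const_mul _)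
    rw [hnorm]
    have := (hMb y ⟨hy.1.le, hy.2⟩).trans hM43
    gcongr

theorem le_integral_sq_sine_solution (hδ : 0 < δ) (hq : IntervalIntegrable q volume 0 δ)
    (hk : 0 < κ.re) (hη : ∫ y in 0..δ, |q y| ≤ ‖κ‖ / 4) (hE : 36 ≤ Real.exp (2 * κ.re * δ))
    (hφ : SolvesOn q (-κ ^ 2) 0 δ φ φ') (h0 : φ 0 = 0) (h0' : φ' 0 = 1) :
    Real.exp (2 * κ.re * δ) / (192 * κ.re * ‖κ‖ ^ 2) ≤ ∫ y in 0..δ, ‖φ y‖ ^ 2 := by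
  have hκ : 0 < ‖κ‖ := norm_pos_iff.2 fun h => by simp [h] at hk
  set k := κ.re with hkdef
  set x₁ := Real.log 12 / (2 * k) with hx₁
  have hx₁0 : 0 ≤ x₁ := div_nonneg (Real.log_nonneg (by norm_num)) (by linarith)
  have hx₁e : Real.exp (2 * k * x₁) = 12 := by
    rw [hx₁, mul_div_cancel₀ _ (by positivity), Real.exp_log (by norm_num)]
  have hx₁δ : x₁ ≤ δ := by
    have : Real.exp (2 * k * x₁) ≤ Real.exp (2 * k * δ) := by rw [hx₁e]; linarith
    rw [Real.exp_le_exp] at this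
    exact le_of_mul_le_mul_left this (by positivity)
  have hi := hφ.intervalIntegrable_sq hδ.le le_rfl hδ.le le_rfl
  have h1 : ∫ y in x₁..δ, ‖φ y‖ ^ 2 ≤ ∫ y in 0..δ, ‖φ y‖ ^ 2 :=
    intervalIntegral.integral_mono_interval hx₁0 hx₁δ le_rfl
      (Eventually.of_forall fun y => by positivity) hi
  have h2 : ∫ y in x₁..δ, (1 / (64 * ‖κ‖ ^ 2)) * Real.exp (2 * k * y)
      ≤ ∫ y in x₁..δ, ‖φ y‖ ^ 2 := by
    refine intervalIntegral.integral_mono_on hx₁δ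
      (by apply Continuous.intervalIntegrable; fun_prop)
      (hφ.intervalIntegrable_sq hδ.le hx₁0 hx₁δ le_rfl) fun y hy => ?_
    have hb := (sine_solution_bounds hδ.le hq hk hη hφ h0 h0' ⟨hx₁0.trans hy.1, hy.2⟩).2
    have he : 12 ≤ Real.exp (2 * k * y) := by
      rw [← hx₁e]; apply Real.exp_le_exp.2; gcongr; exact hy.1
    have hs : Real.exp (2 * k * y) = Real.exp (k * y) * Real.exp (k * y) := by
      rw [← Real.exp_add]; ring_nf
    have hb2 : Real.exp (k * y) / 4 ≤ 2 * ‖κ‖ * ‖φ y‖ := by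
      refine le_trans ?_ hb
      have h5 : Real.exp (-(k * y)) ≤ Real.exp (k * y) / 12 := by
        rw [Real.exp_neg, inv_le_iff_one_le_mul₀ (Real.exp_pos _)]
        rw [hs] at he
        linarith
      linarith
    rw [hs, one_div, inv_mul_le_iff₀ (by positivity)]
    have := mul_self_le_mul_self (by positivity) hb2
    nlinarith
  refine le_trans ?_ (h2.trans h1)
  have hdom : ∫ y in x₁..δ, Real.exp (2 * k * y)
      = (Real.exp (2 * k * δ) - Real.exp (2 * k * x₁)) / (2 * k) := by
    have hd : ∀ y ∈ uIcc x₁ δ, HasDerivAt (fun y => Real.exp (2 * k * y) / (2 * k))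
        (Real.exp (2 * k * y)) y := by
      intro y _
      have h := (((hasDerivAt_id' y).const_mul (2 * k)).exp).div_const (2 * k)
      exact h.congr_deriv (by field_simp)
    rw [intervalIntegral.integral_eq_sub_of_hasDerivAt hd
      (by apply Continuous.intervalIntegrable; fun_prop)]
    ring
  rw [intervalIntegral.integral_const_mul, hdom, hx₁e]
  rw [div_mul_div_comm, div_le_div_iff₀ (by positivity) (by positivity)]
  have : 0 < k * ‖κ‖ ^ 2 := by positivity
  nlinarith

/-- If the logarithmic derivative of `u` at `δ` is in the closed half-plane of `z`, then `u δ` is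
controlled by `u 0`. -/
theorem SolvesOn.norm_mul_le {z : ℂ} {u u' : ℝ → ℂ} (hδ : 0 ≤ δ) (hu : SolvesOn q z 0 δ u u')
    (hφ : SolvesOn q z 0 δ φ φ') (p0 : φ 0 = 0) (p0' : φ' 0 = 1) (hz : z.im ≠ 0)
    (hsign : 0 ≤ (conj (u δ) * u' δ).im * z.im) :
    ‖u δ‖ * (|z.im| * ∫ y in 0..δ, ‖φ y‖ ^ 2) ≤ ‖u 0‖ * ‖φ δ‖ := by
  have hmem : δ ∈ Icc 0 δ := ⟨hδ, le_rfl⟩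
  have hu0 : u 0 = u δ * φ' δ - u' δ * φ δ := by
    have := hu.wronskian_const hδ hφ hmem
    rw [p0, p0'] at this
    linear_combination -this
  have hφim := hφ.im_sub_im hδ le_rfl hδ le_rfl
  rw [p0] at hφim
  simp only [map_zero, zero_mul, Complex.zero_im, sub_zero] at hφim
  set J := ∫ y in 0..δ, ‖φ y‖ ^ 2 with hJ
  by_cases hv : u δ = 0
  · rw [hv]; simp; positivity
  have hvpos : 0 < ‖u δ‖ := norm_pos_iff.2 hv
  have e1 : (u 0 * (conj (u δ) * conj (φ δ))).im
      = ‖u δ‖ ^ 2 * (conj (φ δ) * φ' δ).im - ‖φ δ‖ ^ 2 * (conj (u δ) * u' δ).im := by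
    rw [hu0]
    have e3 : (u δ * φ' δ - u' δ * φ δ) * (conj (u δ) * conj (φ δ))
        = ((‖u δ‖ ^ 2 : ℝ) : ℂ) * (conj (φ δ) * φ' δ)
          - ((‖φ δ‖ ^ 2 : ℝ) : ℂ) * (conj (u δ) * u' δ) := by
      push_cast
      rw [← Complex.conj_mul', ← Complex.conj_mul']; ring
    rw [e3, Complex.sub_im, Complex.im_ofReal_mul, Complex.im_ofReal_mul]
  have e2 : ‖u δ‖ ^ 2 * (|z.im| * J) * |z.im|
      ≤ |(u 0 * (conj (u δ) * conj (φ δ))).im| * |z.im| := by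
    rw [← abs_mul]
    refine le_trans ?_ (neg_le_abs _)
    rw [e1, hφim]
    have h3 : |z.im| * |z.im| = z.im * z.im := abs_mul_abs_self _
    have h4 := mul_nonneg (sq_nonneg ‖φ δ‖) hsign
    have h5 : ‖u δ‖ ^ 2 * (|z.im| * J) * |z.im|
        = ‖u δ‖ ^ 2 * J * (z.im * z.im) := by rw [← h3]; ring
    rw [h5]
    linarith
  have h6 : 0 < |z.im| := abs_pos.2 hz
  have e4 := le_of_mul_le_mul_right e2 h6
  have e5 : |(u 0 * (conj (u δ) * conj (φ δ))).im| ≤ ‖u δ‖ * (‖u 0‖ * ‖φ δ‖) := by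
    refine (Complex.abs_im_le_norm _).trans (le_of_eq ?_)
    rw [norm_mul, norm_mul, Complex.norm_conj, Complex.norm_conj]; ring
  have e6 : ‖u δ‖ * (‖u δ‖ * (|z.im| * J)) ≤ ‖u δ‖ * (‖u 0‖ * ‖φ δ‖) := by nlinarith
  exact le_of_mul_le_mul_left e6 hvpos

/-- The Möbius map that sends the logarithmic derivative at `δ` to the one at `0` takes the closed
half-plane into a small disc around the value of the Jost-type solution. -/
theorem logDeriv_add_le {η : ℝ} {u u' : ℝ → ℂ} (hδ : 0 < δ) (hq : IntegrableOn q (Ioo 0 δ))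
    (hη : ∫ y in 0..δ, |q y| ≤ η) (hk : 4 * η ≤ κ.re) (hkδ : δ⁻¹ * Real.log 6 ≤ κ.re)
    (him : κ.im ≠ 0) (hu : SolvesOn q (-κ ^ 2) 0 δ u u')
    (hsign : 0 ≤ (conj (u δ) * u' δ).im * (-κ ^ 2).im) (hne : u δ ≠ 0 ∨ u' δ ≠ 0) :
    u 0 ≠ 0 ∧ ‖u' 0 / u 0 + κ‖ ≤ 2 * (∫ y in 0..δ, Real.exp (-2 * κ.re * y) * |q y|)
      + 864 / 5 * (‖κ‖ ^ 2 / |κ.im|) * Real.exp (-2 * δ * κ.re) := by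
  have hlog : 0 < Real.log 6 := Real.log_pos (by norm_num)
  have hk0 : 0 < κ.re := lt_of_lt_of_le (mul_pos (inv_pos.2 hδ) hlog) hkδ
  have hκ : 0 < ‖κ‖ := norm_pos_iff.2 fun h => by simp [h] at hk0
  have hqi := intervalIntegrable_of_Ioo hδ.le hq
  have hη' : ∫ y in 0..δ, |q y| ≤ ‖κ‖ / 4 := by
    have := Complex.re_le_norm κ
    linarith
  have hE6 : 6 ≤ Real.exp (κ.re * δ) := by
    rw [← Real.log_le_iff_le_exp (by norm_num)]
    rwa [inv_mul_le_iff₀ hδ, mul_comm] at hkδ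
  have hEsq : Real.exp (2 * κ.re * δ) = Real.exp (κ.re * δ) * Real.exp (κ.re * δ) := by
    rw [← Real.exp_add]; ring_nf
  have hE : 36 ≤ Real.exp (2 * κ.re * δ) := by rw [hEsq]; nlinarith
  obtain ⟨φ, φ', p0, p0', hφ⟩ := exists_solvesOn hδ.le hq (-κ ^ 2) 0 1
  have hmem : δ ∈ Icc 0 δ := ⟨hδ.le, le_rfl⟩
  set e := Complex.exp (-κ * δ) with he
  obtain ⟨f, f', hfδ, hfδ', hf⟩ := exists_solvesOn_final hδ.le hq (-κ ^ 2) e (-κ * e)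
  obtain ⟨hf0, hfm⟩ := jost_solution_bounds hδ.le hqi hk0 hη' hf hfδ hfδ'
  obtain ⟨hP, hφδ⟩ := sine_solution_bounds hδ.le hqi hk0 hη' hφ p0 p0' hmem
  have hD := le_integral_sq_sine_solution hδ hqi hk0 hη' hE hφ p0 p0'
  set J := ∫ y in 0..δ, ‖φ y‖ ^ 2 with hJ
  set X := Real.exp (κ.re * δ) with hX
  have hX0 : 0 < X := Real.exp_pos _
  have hφ0 : 11 / 72 * X / ‖κ‖ ≤ ‖φ δ‖ := by
    rw [div_le_iff₀ hκ]
    have : Real.exp (-(κ.re * δ)) ≤ X / 36 := by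
      rw [Real.exp_neg, inv_le_iff_one_le_mul₀ hX0]; nlinarith
    nlinarith
  set P := φ' δ + κ * φ δ with hPdef
  have hP0 : 0 < ‖P‖ := lt_of_lt_of_le (by positivity) hP
  have hφpos : 0 < ‖φ δ‖ := lt_of_lt_of_le (by positivity) hφ0
  have hzim : (-κ ^ 2).im = -2 * κ.re * κ.im := by
    rw [sq]; simp; ring
  have hzabs : |(-κ ^ 2).im| = 2 * κ.re * |κ.im| := by
    rw [hzim, abs_mul, abs_mul, abs_of_pos hk0]; simp
  have himpos : 0 < |κ.im| := abs_pos.2 him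
  have hJpos : 0 < J := lt_of_lt_of_le (by positivity) hD
  set D := |(-κ ^ 2).im| * J with hDdef
  have hDpos : 0 < D := by rw [hDdef, hzabs]; positivity
  have hu0 : u 0 = u δ * φ' δ - u' δ * φ δ := by
    have := hu.wronskian_const hδ.le hφ hmem
    rw [p0, p0'] at this
    linear_combination -this
  have hz0 : (-κ ^ 2).im ≠ 0 := by rw [hzim]; simp [hk0.ne', him]
  have hvD : ‖u δ‖ * D ≤ ‖u 0‖ * ‖φ δ‖ := hu.norm_mul_le hδ.le hφ p0 p0' hz0 hsign
  have hu0ne : u 0 ≠ 0 := by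
    intro h
    rw [h, norm_zero, zero_mul] at hvD
    have hv : u δ = 0 := by
      rw [← norm_eq_zero]
      exact le_antisymm (nonpos_of_mul_nonpos_left hvD hDpos) (norm_nonneg _)
    rw [hv, h] at hu0
    rcases hne with h1 | h1
    · exact h1 hv
    · have : u' δ * φ δ = 0 := by linear_combination hu0
      rcases mul_eq_zero.1 this with h2 | h2
      · exact h1 h2
      · exact (norm_pos_iff.1 hφpos) h2
  refine ⟨hu0ne, ?_⟩
  have hu0pos : 0 < ‖u 0‖ := norm_pos_iff.2 hu0ne
  have hf0ne : f 0 ≠ 0 := norm_pos_iff.1 (lt_of_lt_of_le (by norm_num) hf0)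
  have hPne : P ≠ 0 := norm_pos_iff.1 hP0
  have hfP : f δ * P = f 0 := by
    have := hf.wronskian_const hδ.le hφ hmem
    rw [p0, p0', hfδ'] at this
    rw [hPdef]
    rw [hfδ] at this ⊢
    linear_combination this
  have hS : u' 0 / u 0 + κ = (f' 0 + κ * f 0) / f 0 + (u' δ + κ * u δ) / (u 0 * P) := by
    have h1 := hf.wronskian_const hδ.le hu hmem
    have h2 : f 0 * u' 0 - f' 0 * u 0 = f δ * (u' δ + κ * u δ) := by
      rw [← h1, hfδ', hfδ]; ring
    have h3 : (u' δ + κ * u δ) / (u 0 * P) = (f δ * (u' δ + κ * u δ)) / (u 0 * f 0) := by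
      rw [← hfP]
      have : f δ ≠ 0 := by rw [hfδ]; exact Complex.exp_ne_zero _
      field_simp
    rw [h3, ← h2]
    field_simp
    ring
  rw [hS]
  refine (norm_add_le _ _).trans (add_le_add ?_ ?_)
  · rw [norm_div, div_le_iff₀ (lt_of_lt_of_le (by norm_num) hf0)]
    refine hfm.trans ?_
    have : 0 ≤ ∫ y in 0..δ, Real.exp (-2 * κ.re * y) * |q y| :=
      intervalIntegral.integral_nonneg hδ.le fun y _ => by positivity
    nlinarith
  · have h1 : ‖u' δ + κ * u δ‖ * ‖φ δ‖ ≤ ‖u 0‖ + ‖u δ‖ * ‖P‖ := by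
      have : (u' δ + κ * u δ) * φ δ = -u 0 + u δ * P := by rw [hu0, hPdef]; ring
      rw [← norm_mul, this]
      refine (norm_add_le _ _).trans ?_
      rw [norm_neg, norm_mul]
    have h2 : ‖u' δ + κ * u δ‖ ≤ ‖u 0‖ * (1 / ‖φ δ‖ + ‖P‖ / D) := by
      have h3 : ‖u δ‖ ≤ ‖u 0‖ * ‖φ δ‖ / D := by rwa [le_div_iff₀ hDpos]
      have h4 : ‖u' δ + κ * u δ‖ * ‖φ δ‖ ≤ (‖u 0‖ * (1 / ‖φ δ‖ + ‖P‖ / D)) * ‖φ δ‖ := by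
        refine h1.trans ?_
        calc ‖u 0‖ + ‖u δ‖ * ‖P‖ ≤ ‖u 0‖ + (‖u 0‖ * ‖φ δ‖ / D) * ‖P‖ := by gcongr
          _ = _ := by field_simp
      exact le_of_mul_le_mul_right h4 hφpos
    have h5 : ‖(u' δ + κ * u δ) / (u 0 * P)‖ ≤ 1 / (‖φ δ‖ * ‖P‖) + 1 / D := by
      rw [norm_div, norm_mul, div_le_iff₀ (by positivity)]
      refine h2.trans (le_of_eq ?_)
      field_simp
    refine h5.trans ?_
    have hexp : Real.exp (-2 * δ * κ.re) = 1 / (X * X) := by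
      rw [hX, ← Real.exp_add, one_div, ← Real.exp_neg]; ring_nf
    have hκim : |κ.im| ≤ ‖κ‖ := Complex.abs_im_le_norm κ
    have h6 : 1 / (‖φ δ‖ * ‖P‖) ≤ 108 / 11 * (‖κ‖ ^ 2 / |κ.im|) * (1 / (X * X)) := by
      have h7 : (11 / 72 * X / ‖κ‖) * (2 / 3 * X) ≤ ‖φ δ‖ * ‖P‖ := by gcongr
      have h8 : ‖κ‖ ≤ ‖κ‖ ^ 2 / |κ.im| := by
        rw [le_div_iff₀ himpos, sq]; gcongr
      calc 1 / (‖φ δ‖ * ‖P‖) ≤ 1 / ((11 / 72 * X / ‖κ‖) * (2 / 3 * X)) := by gcongr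
        _ = 108 / 11 * ‖κ‖ * (1 / (X * X)) := by field_simp; norm_num
        _ ≤ _ := by gcongr
    have h9 : 1 / D ≤ 96 * (‖κ‖ ^ 2 / |κ.im|) * (1 / (X * X)) := by
      have h10 : 2 * κ.re * |κ.im| * (X * X / (192 * κ.re * ‖κ‖ ^ 2)) ≤ D := by
        rw [hDdef, hzabs]; rw [hEsq] at hD; gcongr
      calc 1 / D ≤ 1 / (2 * κ.re * |κ.im| * (X * X / (192 * κ.re * ‖κ‖ ^ 2))) := by gcongr
        _ = _ := by field_simp; norm_num
    rw [hexp]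
    have h11 : 0 ≤ ‖κ‖ ^ 2 / |κ.im| * (1 / (X * X)) := by positivity
    rw [mul_assoc] at h6 h9 ⊢
    linarith

end

/-! ### Solutions on the interval of an endpoint -/

section

variable {q : ℝ → ℝ} {z : ℂ} {u u' v v' : ℝ → ℂ} {e : Endpoint}

theorem Endpoint.nonneg_of_mem {c : ℝ} (hc : c ∈ e.interval) : 0 ≤ c := by
  cases e with
  | regular b h => exact hc.1
  | squareIntegrable => exact hc
  | limitCircle u₀ u₀' => exact hc

theorem Endpoint.Icc_subset {c : ℝ} (hc : c ∈ e.interval) : Icc 0 c ⊆ e.interval := by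
  cases e with
  | regular b h => exact Icc_subset_Icc_right hc.2
  | squareIntegrable => exact fun x hx => hx.1
  | limitCircle u₀ u₀' => exact fun x hx => hx.1

theorem LocallyIntegrableHalfLine.integrableOn (hq : LocallyIntegrableHalfLine q) (c : ℝ) :
    IntegrableOn q (Ioo 0 c) := by
  rcases lt_or_ge 0 c with h | h
  · exact hq c h
  · rw [Ioo_eq_empty (not_lt.2 h)]; exact integrableOn_empty

theorem Endpoint.integrableOn (he : e.Admissible q) {c : ℝ} (hc : c ∈ e.interval) :
    IntegrableOn q (Ioo 0 c) := by
  cases e with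
  | regular b h => exact he.2.mono_set (Ioo_subset_Ioo_right hc.2)
  | squareIntegrable => exact he.1.integrableOn c
  | limitCircle u₀ u₀' => exact he.1.integrableOn c

theorem Endpoint.mem_interval_of_le {c : ℝ} (hc : 0 ≤ c) (h : (c : EReal) ≤ e.right) :
    c ∈ e.interval := by
  cases e with
  | regular b h' => exact ⟨hc, EReal.coe_le_coe_iff.1 h⟩
  | squareIntegrable => exact hc
  | limitCircle u₀ u₀' => exact hc

theorem IsSolution.solvesOn_of_subset {I : Set ℝ} (h : IsSolution q z I u u') {c : ℝ} (hc : 0 ≤ c)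
    (hI : Icc 0 c ⊆ I) (hq : IntegrableOn q (Ioo 0 c)) : SolvesOn q z 0 c u u' := by
  have hac := h.absCont c (hI ⟨hc, le_rfl⟩)
  have hc' : ContinuousOn u' (Icc 0 c) := by simpa [uIcc_of_le hc] using hac.continuousOn
  have hcu : ContinuousOn u (Icc 0 c) := fun x hx =>
    ((h.hasDeriv x (hI hx)).mono hI).continuousWithinAt
  have hii : ∀ x ∈ Icc 0 c, IntervalIntegrable u' volume 0 x := fun x hx => by
    refine ContinuousOn.intervalIntegrable ?_
    rw [uIcc_of_le hx.1]; exact hc'.mono (Icc_subset_Icc_right hx.2)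
  refine ⟨⟨hii c ⟨hc, le_rfl⟩, fun x hx => ?_⟩, ?_⟩
  · rw [intervalIntegral.integral_eq_sub_of_hasDerivAt_of_le hx.1
      (hcu.mono (Icc_subset_Icc_right hx.2)) (fun y hy => ?_) (hii x hx)]
    · ring
    · have hy' : y ∈ Icc 0 c := ⟨hy.1.le, hy.2.le.trans hx.2⟩
      exact ((h.hasDeriv y (hI hy')).mono hI).hasDerivAt
        (Icc_mem_nhds hy.1 (hy.2.trans_le hx.2))
  · refine IsPrimitiveOn.of_absolutelyContinuous hc hac ?_ ?_
    · have h1 : IntervalIntegrable (fun x => (q x : ℂ) - z) volume 0 c :=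
        IntervalIntegrable.sub ⟨(intervalIntegrable_of_Ioo hc hq).1.ofReal,
          (intervalIntegrable_of_Ioo hc hq).2.ofReal⟩ intervalIntegrable_const
      exact h1.mul_continuousOn (by rwa [uIcc_of_le hc])
    · rw [← ae_restrict_iff' measurableSet_Icc]
      exact ae_restrict_of_ae_restrict_of_subset hI h.equation

theorem IsSolution.solvesOn (he : e.Admissible q) (h : IsSolution q z e.interval u u') {c : ℝ}
    (hc : c ∈ e.interval) : SolvesOn q z 0 c u u' :=
  h.solvesOn_of_subset (e.nonneg_of_mem hc) (e.Icc_subset hc) (e.integrableOn he hc)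

theorem IsSolution.solvesOn_Ici (hq : LocallyIntegrableHalfLine q)
    (h : IsSolution q z (Ici 0) u u') {c : ℝ} (hc : 0 ≤ c) : SolvesOn q z 0 c u u' :=
  h.solvesOn_of_subset hc (fun _ hx => hx.1) (hq.integrableOn c)

theorem SolvesOn.hasDerivWithinAt {c : ℝ} (hc : 0 ≤ c) (h : SolvesOn q z 0 c u u') {x : ℝ}
    (hx : x ∈ Icc 0 c) : HasDerivWithinAt u (u' x) (Icc 0 c) x := by
  have hcont : Continuous (IccExtend hc ((Icc 0 c).domRestrict u')) :=
    (continuousOn_iff_continuous_domRestrict.1 (h.continuousOn' hc)).Icc_extend'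
  have heq : ∀ y ∈ Icc 0 c, IccExtend hc ((Icc 0 c).domRestrict u') y = u' y := fun y hy => by
    rw [IccExtend_of_mem hc _ hy]; rfl
  have hd : HasDerivAt (fun y => u 0 + ∫ t in 0..y, IccExtend hc ((Icc 0 c).domRestrict u') t)
      (u' x) x := by
    rw [← heq x hx]
    exact (hcont.integral_hasStrictDerivAt 0 x).hasDerivAt.const_add _
  have hu : ∀ y ∈ Icc 0 c, u y = u 0 + ∫ t in 0..y, IccExtend hc ((Icc 0 c).domRestrict u') t := by
    intro y hy
    rw [h.left.eq_add_integral y hy]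
    congr 1
    refine intervalIntegral.integral_congr fun t ht => ?_
    rw [uIcc_of_le hy.1] at ht
    exact (heq t ⟨ht.1, ht.2.trans hy.2⟩).symm
  exact hd.hasDerivWithinAt.congr hu (hu x hx)

theorem SolvesOn.isSolution_Icc {b : ℝ} (hb : 0 ≤ b) (h : SolvesOn q z 0 b u u') :
    IsSolution q z (Icc 0 b) u u' := by
  refine ⟨fun x hx => h.hasDerivWithinAt hb hx, fun c hc => ?_, ?_⟩
  · exact (h.mono hb le_rfl hc.1 hc.2).right.absolutelyContinuous hc.1
  · rw [ae_restrict_iff' measurableSet_Icc]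
    exact h.right.ae_hasDerivAt hb

theorem isSolution_Ici (h : ∀ c, 0 ≤ c → SolvesOn q z 0 c u u') :
    IsSolution q z (Ici 0) u u' := by
  refine ⟨fun x hx => ?_, fun c hc => (h c hc).right.absolutelyContinuous hc, ?_⟩
  · have hx0 : 0 ≤ x := hx
    have hx1 : 0 ≤ x + 1 := by linarith
    refine ((h (x + 1) hx1).hasDerivWithinAt hx1 ⟨hx0, by linarith⟩).mono_of_mem_nhdsWithin ?_
    rw [← Ici_inter_Iic]
    exact inter_mem self_mem_nhdsWithin
      (mem_nhdsWithin_of_mem_nhds (Iic_mem_nhds (by linarith)))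
  · rw [ae_restrict_iff' measurableSet_Ici]
    have : ∀ n : ℕ, ∀ᵐ x, x ∈ Icc (0 : ℝ) n → HasDerivAt u' (((q x : ℂ) - z) * u x) x := fun n =>
      (h n n.cast_nonneg).right.ae_hasDerivAt n.cast_nonneg
    filter_upwards [ae_all_iff.2 this] with x hx hx0
    exact hx ⌈x⌉₊ ⟨hx0, Nat.le_ceil x⟩

/-- A solution with zero Cauchy data at `0` vanishes. -/
theorem SolvesOn.eq_zero_of_initial {c : ℝ} (hc : 0 ≤ c) (hq : IntegrableOn q (Ioo 0 c))
    (h : SolvesOn q z 0 c u u') (h0 : u 0 = 0) (h0' : u' 0 = 0) {x : ℝ} (hx : x ∈ Icc 0 c) :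
    u x = 0 ∧ u' x = 0 := by
  obtain ⟨θ, θ', a1, a2, hθ⟩ := exists_solvesOn hc hq z 1 0
  obtain ⟨φ, φ', b1, b2, hφ⟩ := exists_solvesOn hc hq z 0 1
  exact h.eq_zero hc hθ hφ (by simp [a1, a2, b1, b2]) h0 h0' hx

theorem SolvesOn.ne_zero_at {c : ℝ} (hc : 0 ≤ c) (hq : IntegrableOn q (Ioo 0 c))
    (h : SolvesOn q z 0 c u u') (h0 : u 0 ≠ 0 ∨ u' 0 ≠ 0) : u c ≠ 0 ∨ u' c ≠ 0 := by
  by_contra! hcon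
  obtain ⟨θ, θ', a1, a2, hθ⟩ := exists_solvesOn hc hq z 1 0
  obtain ⟨φ, φ', b1, b2, hφ⟩ := exists_solvesOn hc hq z 0 1
  have e1 := h.wronskian_const hc hθ ⟨hc, le_rfl⟩
  have e2 := h.wronskian_const hc hφ ⟨hc, le_rfl⟩
  rw [hcon.1, hcon.2, a1, a2] at e1
  rw [hcon.1, hcon.2, b1, b2] at e2
  rcases h0 with h0 | h0
  · exact h0 (by linear_combination -e2)
  · exact h0 (by linear_combination e1)

theorem initial_ne_zero (he : e.Admissible q) (h : IsSolution q z e.interval u u')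
    (hn : IsNonzeroOn e.interval u) : u 0 ≠ 0 ∨ u' 0 ≠ 0 := by
  by_contra! hcon
  obtain ⟨x, hx, hux⟩ := hn
  exact hux ((h.solvesOn he hx).eq_zero_of_initial (e.nonneg_of_mem hx) (e.integrableOn he hx)
    hcon.1 hcon.2 ⟨e.nonneg_of_mem hx, le_rfl⟩).1

theorem isNonzeroOn_of_initial {I : Set ℝ} (hI : UniqueDiffOn ℝ I) (h0I : 0 ∈ I)
    (h : IsSolution q z I u u') (h0 : u 0 ≠ 0 ∨ u' 0 ≠ 0) : IsNonzeroOn I u := by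
  by_contra hcon
  have hz : ∀ x ∈ I, u x = 0 := fun x hx => by
    by_contra hne; exact hcon ⟨x, hx, hne⟩
  have hd : HasDerivWithinAt u 0 I 0 :=
    (hasDerivWithinAt_const (0 : ℝ) I (0 : ℂ)).congr hz (hz 0 h0I)
  have := (hI 0 h0I).eq_deriv _ (h.hasDeriv 0 h0I) hd
  rcases h0 with h0 | h0
  · exact h0 (hz 0 h0I)
  · exact h0 this

/-- `ψ` is a Weyl solution whose logarithmic derivative is in the half-plane of `z`, and which
determines all other Weyl solutions. -/
structure IsWeylGenerator (q : ℝ → ℝ) (e : Endpoint) (z : ℂ) (ψ ψ' : ℝ → ℂ) : Prop where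
  isWeyl : IsWeylSolution q e z ψ ψ'
  im_nonneg : ∀ x ∈ e.interval, 0 ≤ (conj (ψ x) * ψ' x).im * z.im
  wronskian_eq : ∀ v v' : ℝ → ℂ, IsWeylSolution q e z v v' → ψ 0 * v' 0 - ψ' 0 * v 0 = 0

theorem IsWeylGenerator.isWeylM {ψ ψ' : ℝ → ℂ} (he : e.Admissible q)
    (h : IsWeylGenerator q e z ψ ψ') (h0 : ψ 0 ≠ 0) : IsWeylM q e z (ψ' 0 / ψ 0) := by
  refine ⟨⟨ψ, ψ', h.isWeyl⟩, fun v v' hv => ?_⟩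
  have hW := h.wronskian_eq v v' hv
  have hv0 : v 0 ≠ 0 := by
    intro hv0
    rcases initial_ne_zero he hv.1 hv.2.1 with h1 | h1
    · exact h1 hv0
    · rw [hv0, mul_zero, sub_zero] at hW
      exact (mul_ne_zero h0 h1) hW
  refine ⟨hv0, ?_⟩
  rw [div_eq_div_iff hv0 h0]
  linear_combination hW

theorem exists_weylGenerator_regular {b : ℝ} {h : OnePoint ℝ}
    (he : (Endpoint.regular b h).Admissible q) (z : ℂ) :
    ∃ ψ ψ', IsWeylGenerator q (.regular b h) z ψ ψ' := by
  have hb : 0 < b := he.1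
  have key : ∀ A B : ℂ, (A ≠ 0 ∨ B ≠ 0) → (conj A * B).im = 0 →
      (∀ v v' : ℝ → ℂ, (Endpoint.regular b h).Satisfies v v' ↔ A * v' b - B * v b = 0) →
      ∃ ψ ψ', IsWeylGenerator q (.regular b h) z ψ ψ' := by
    intro A B hAB him hsat
    obtain ⟨ψ, ψ', h1, h2, hψ⟩ := exists_solvesOn_final hb.le he.2 z A B
    have hsol : IsSolution q z (Icc 0 b) ψ ψ' := hψ.isSolution_Icc hb.le
    have hi : ψ 0 ≠ 0 ∨ ψ' 0 ≠ 0 := by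
      by_contra! hcon
      have := hψ.eq_zero_of_initial hb.le he.2 hcon.1 hcon.2 ⟨hb.le, le_rfl⟩
      rw [h1, h2] at this
      tauto
    refine ⟨ψ, ψ', ⟨hsol, isNonzeroOn_of_initial (uniqueDiffOn_Icc hb) ⟨le_rfl, hb.le⟩ hsol hi,
      (hsat _ _).2 (by rw [h1, h2]; ring)⟩, fun x hx => ?_, fun v v' hv => ?_⟩
    · have hE := hψ.im_sub_im hb.le hx.1 hx.2 le_rfl
      rw [h1, h2, him] at hE
      have hI : 0 ≤ ∫ t in x..b, ‖ψ t‖ ^ 2 :=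
        intervalIntegral.integral_nonneg hx.2 fun t _ => by positivity
      have : (conj (ψ x) * ψ' x).im = z.im * ∫ t in x..b, ‖ψ t‖ ^ 2 := by linarith
      rw [this, mul_right_comm]
      exact mul_nonneg (mul_self_nonneg _) hI
    · have hv1 : SolvesOn q z 0 b v v' := hv.1.solvesOn he ⟨hb.le, le_rfl⟩
      rw [← hψ.wronskian_const hb.le hv1 ⟨hb.le, le_rfl⟩, h1, h2]
      exact (hsat v v').1 hv.2.2
  cases h with
  | infty =>
    refine key 0 1 (by simp) (by simp) fun v v' => ?_
    change v b = 0 ↔ _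
    simp
  | coe h =>
    refine key 1 (-(h : ℂ)) (by simp) (by simp) fun v v' => ?_
    change v' b + (h : ℂ) * v b = 0 ↔ _
    simp

end

/-! ### Square integrable solutions on the half-line -/

/-- A square integrable solution on the half-line. -/
structure IsL2Solution (q : ℝ → ℝ) (z : ℂ) (u u' : ℝ → ℂ) : Prop where
  solves : ∀ c, 0 ≤ c → SolvesOn q z 0 c u u'
  sq : IntegrableOn (fun x => ‖u x‖ ^ 2) (Ioi 0)

section

variable {q : ℝ → ℝ} {z z₁ z₂ : ℂ} {u u' v v' : ℝ → ℂ}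

theorem continuousOn_Ici_of_Icc {g : ℝ → ℂ} (h : ∀ c, 0 ≤ c → ContinuousOn g (Icc 0 c)) :
    ContinuousOn g (Ici 0) := by
  intro x hx
  have hx0 : 0 ≤ x := hx
  refine (h (x + 1) (by linarith) x ⟨hx0, by linarith⟩).mono_of_mem_nhdsWithin ?_
  rw [← Ici_inter_Iic]
  exact inter_mem self_mem_nhdsWithin (mem_nhdsWithin_of_mem_nhds (Iic_mem_nhds (by linarith)))

theorem continuousOn_Ici (h : ∀ c, 0 ≤ c → SolvesOn q z 0 c u u') : ContinuousOn u (Ici 0) :=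
  continuousOn_Ici_of_Icc fun c hc => (h c hc).continuousOn hc

theorem continuousOn_Ici' (h : ∀ c, 0 ≤ c → SolvesOn q z 0 c u u') : ContinuousOn u' (Ici 0) :=
  continuousOn_Ici_of_Icc fun c hc => (h c hc).continuousOn' hc

theorem isL2Solution_of_isL2AtInfinity (h : ∀ c, 0 ≤ c → SolvesOn q z 0 c u u')
    (h2 : IsL2AtInfinity u) : IsL2Solution q z u u' := by
  obtain ⟨R, hR, hi⟩ := h2
  refine ⟨h, ?_⟩
  rw [← Ioc_union_Ioi_eq_Ioi hR]
  refine IntegrableOn.union ?_ hi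
  rw [← intervalIntegrable_iff_integrableOn_Ioc_of_le hR]
  exact (h R hR).intervalIntegrable_sq hR le_rfl hR le_rfl

theorem IsL2Solution.isL2AtInfinity (h : IsL2Solution q z u u') : IsL2AtInfinity u :=
  ⟨0, le_rfl, h.sq⟩

theorem IsL2Solution.star (h : IsL2Solution q z u u') :
    IsL2Solution q (conj z) (fun x => conj (u x)) (fun x => conj (u' x)) :=
  ⟨fun c hc => (h.solves c hc).star, by simpa using h.sq⟩

theorem integrableOn_mul_of_sq {a : ℝ} (ha : 0 ≤ a) (hu : ContinuousOn u (Ici 0))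
    (hv : ContinuousOn v (Ici 0)) (hu2 : IntegrableOn (fun x => ‖u x‖ ^ 2) (Ioi a))
    (hv2 : IntegrableOn (fun x => ‖v x‖ ^ 2) (Ioi a)) :
    IntegrableOn (fun x => u x * v x) (Ioi a) := by
  refine Integrable.mono' (hu2.add hv2) ?_ (Eventually.of_forall fun x => ?_)
  · exact ((hu.mul hv).mono fun x (hx : a < x) => ha.trans hx.le).aestronglyMeasurable
      measurableSet_Ioi
  · rw [norm_mul, Pi.add_apply]
    nlinarith [sq_nonneg (‖u x‖ - ‖v x‖), sq_nonneg ‖u x‖, sq_nonneg ‖v x‖]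

/-- The Wronskian of two square integrable solutions has a limit. -/
theorem IsL2Solution.exists_tendsto_wronskian (h : IsL2Solution q z₁ u u')
    (k : IsL2Solution q z₂ v v') :
    ∃ l : ℂ, Tendsto (fun x => u x * v' x - u' x * v x) atTop (𝓝 l) := by
  have hi := integrableOn_mul_of_sq le_rfl (continuousOn_Ici h.solves) (continuousOn_Ici k.solves)
    h.sq k.sq
  have ht := intervalIntegral_tendsto_integral_Ioi 0 (hi.const_mul (z₁ - z₂)) tendsto_id
  refine ⟨_, (ht.const_add (u 0 * v' 0 - u' 0 * v 0)).congr' ?_⟩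
  filter_upwards [eventually_ge_atTop 0] with x hx
  rw [((h.solves x hx).wronskian hx (k.solves x hx)).eq_add_integral x ⟨hx, le_rfl⟩]
  congr 1
  exact intervalIntegral.integral_congr fun t _ => by ring

theorem SolvesOn.integral_sq_pos {c : ℝ} (hc : 0 < c) (h : SolvesOn q z 0 c u u')
    (h0 : u 0 ≠ 0 ∨ u' 0 ≠ 0) : 0 < ∫ t in 0..c, ‖u t‖ ^ 2 := by
  obtain ⟨x, hx, hux⟩ := isNonzeroOn_of_initial (uniqueDiffOn_Icc hc) ⟨le_rfl, hc.le⟩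
    (h.isSolution_Icc hc.le) h0
  refine intervalIntegral.integral_pos hc ((h.continuousOn hc.le).norm.pow 2)
    (fun _ _ => by positivity) ⟨x, hx, ?_⟩
  have := norm_pos_iff.2 hux
  positivity

/-- Weyl's construction of a square integrable solution. -/
theorem exists_isL2Solution (hq : LocallyIntegrableHalfLine q) (hz : z.im ≠ 0) :
    ∃ ψ ψ' : ℝ → ℂ, IsL2Solution q z ψ ψ' ∧ ψ 0 = 1 ∧
      ∀ x, 0 ≤ x → 0 ≤ (conj (ψ x) * ψ' x).im * z.im := by
  obtain ⟨θ, θ', t0, t0', hθ⟩ := exists_solvesOn_halfLine hq z 1 0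
  obtain ⟨φ, φ', p0, p0', hφ⟩ := exists_solvesOn_halfLine hq z 0 1
  have hzpos : 0 < |z.im| := abs_pos.2 hz
  have hφne : ∀ x, 0 < x → φ x ≠ 0 := by
    intro x hx h0
    have hE := (hφ x hx.le).im_sub_im hx.le le_rfl hx.le le_rfl
    rw [h0, p0] at hE
    simp only [map_zero, zero_mul, Complex.zero_im, sub_zero] at hE
    have hp := (hφ x hx.le).integral_sq_pos hx (Or.inr (by simp [p0']))
    exact (mul_ne_zero (neg_ne_zero.2 hz) hp.ne') hE.symm
  have hsol : ∀ m : ℂ, ∀ c, 0 ≤ c →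
      SolvesOn q z 0 c (fun x => θ x + m * φ x) (fun x => θ' x + m * φ' x) := fun m c hc =>
    (hθ c hc).add hc ((hφ c hc).const_mul m)
  have hN : ∀ n : ℕ, (0 : ℝ) < n + 1 := fun n => by positivity
  set m : ℕ → ℂ := fun n => -θ (n + 1) / φ (n + 1) with hm
  have hend : ∀ n : ℕ, θ (n + 1) + m n * φ (n + 1) = 0 := fun n => by
    have := hφne _ (hN n)
    simp only [hm]; field_simp; ring
  have hsign : ∀ (n : ℕ) (x : ℝ), 0 ≤ x → x ≤ n + 1 →
      0 ≤ (conj (θ x + m n * φ x) * (θ' x + m n * φ' x)).im * z.im := by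
    intro n x hx hxn
    have hE := (hsol (m n) _ (hN n).le).im_sub_im (hN n).le hx hxn le_rfl
    rw [hend n] at hE
    simp only [map_zero, zero_mul, Complex.zero_im, zero_sub] at hE
    have hI : 0 ≤ ∫ t in x..(n + 1 : ℝ), ‖θ t + m n * φ t‖ ^ 2 :=
      intervalIntegral.integral_nonneg hxn fun t _ => by positivity
    rw [neg_mul, neg_inj] at hE
    rw [hE, mul_right_comm]
    exact mul_nonneg (mul_self_nonneg _) hI
  have h1 : (0 : ℝ) ≤ 1 := zero_le_one
  have hJ := (hφ 1 h1).integral_sq_pos one_pos (Or.inr (by simp [p0']))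
  set J := ∫ t in (0 : ℝ)..1, ‖φ t‖ ^ 2 with hJdef
  have hφ1 : 0 < ‖φ 1‖ := norm_pos_iff.2 (hφne 1 one_pos)
  have hbound : ∀ n, ‖m n‖ ≤ (‖θ 1‖ + ‖φ 1‖ / (|z.im| * J)) / ‖φ 1‖ := by
    intro n
    have hle := (hsol (m n) 1 h1).norm_mul_le h1 (hφ 1 h1) p0 p0' hz
      (hsign n 1 h1 (by linarith [n.cast_nonneg (α := ℝ)]))
    simp only [t0, p0, mul_zero, add_zero, norm_one, one_mul] at hle
    rw [← hJdef, ← le_div_iff₀ (by positivity)] at hle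
    rw [le_div_iff₀ hφ1, ← norm_mul]
    have := norm_sub_le (θ 1 + m n * φ 1) (θ 1)
    rw [add_sub_cancel_left] at this
    linarith
  obtain ⟨M, -, σ, hσ, hlim⟩ := tendsto_subseq_of_bounded
    (Metric.isBounded_closedBall (x := (0 : ℂ))
      (r := (‖θ 1‖ + ‖φ 1‖ / (|z.im| * J)) / ‖φ 1‖)) (fun n => by simpa using hbound n)
  have him : ∀ x, 0 ≤ x → 0 ≤ (conj (θ x + M * φ x) * (θ' x + M * φ' x)).im * z.im := by
    intro x hx
    have hcont : Continuous fun w : ℂ => (conj (θ x + w * φ x) * (θ' x + w * φ' x)).im * z.im := by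
      fun_prop
    refine ge_of_tendsto ((hcont.tendsto M).comp hlim) ?_
    filter_upwards [eventually_ge_atTop ⌈x⌉₊] with n hn
    refine hsign (σ n) x hx ?_
    have a1 : x ≤ ⌈x⌉₊ := Nat.le_ceil x
    have a2 : ⌈x⌉₊ ≤ σ n := hn.trans (hσ.id_le n)
    have a3 : (⌈x⌉₊ : ℝ) ≤ σ n := by exact_mod_cast a2
    linarith
  refine ⟨fun x => θ x + M * φ x, fun x => θ' x + M * φ' x, ⟨hsol M, ?_⟩, by simp [t0, p0], him⟩
  refine integrableOn_Ioi_of_intervalIntegral_norm_bounded (|M.im| / |z.im|) 0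
    (b := fun n : ℕ => (n : ℝ)) (fun n => ?_) tendsto_natCast_atTop_atTop
    (Eventually.of_forall fun n => ?_)
  · rw [← intervalIntegrable_iff_integrableOn_Ioc_of_le n.cast_nonneg]
    exact (hsol M n n.cast_nonneg).intervalIntegrable_sq n.cast_nonneg le_rfl n.cast_nonneg le_rfl
  · have hn : (0 : ℝ) ≤ n := n.cast_nonneg
    have hE := (hsol M n hn).im_sub_im hn le_rfl hn le_rfl
    simp only [t0, p0, t0', p0', mul_zero, add_zero, map_one, one_mul, mul_one, zero_add] at hE
    simp only [norm_pow, norm_norm]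
    rw [le_div_iff₀ hzpos]
    have hI : 0 ≤ ∫ t in (0 : ℝ)..n, ‖θ t + M * φ t‖ ^ 2 :=
      intervalIntegral.integral_nonneg hn fun t _ => by positivity
    have hs := him n hn
    set I := ∫ t in (0 : ℝ)..n, ‖θ t + M * φ t‖ ^ 2
    have hle : I * |z.im| * |z.im| ≤ |M.im| * |z.im| := by
      rw [mul_assoc, abs_mul_abs_self, ← abs_mul]
      refine le_trans ?_ (le_abs_self _)
      linear_combination hs + z.im * hE
    exact le_of_mul_le_mul_right hle hzpos

/-! #### Limit point -/

theorem IsLimitPoint.wronskian_eq_zero (hp : IsLimitPoint q)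
    (hz : z.im ≠ 0) (h : IsL2Solution q z u u') (k : IsL2Solution q z v v') :
    u 0 * v' 0 - u' 0 * v 0 = 0 := by
  have key : ∀ {z : ℂ} {u u' v v' : ℝ → ℂ}, 0 < z.im → IsL2Solution q z u u' →
      IsL2Solution q z v v' → u 0 * v' 0 - u' 0 * v 0 = 0 := by
    intro z u u' v v' hz h k
    obtain ⟨w, w', hw, -, -, hun⟩ := hp z hz
    have hmul : ∀ {v v' : ℝ → ℂ}, IsL2Solution q z v v' → ∃ c, v 0 = c * w 0 ∧ v' 0 = c * w' 0 := by
      intro v v' k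
      have hv := isSolution_Ici k.solves
      obtain ⟨c, hc⟩ := hun v v' hv k.isL2AtInfinity
      refine ⟨c, hc 0 self_mem_Ici, ?_⟩
      have hd : HasDerivWithinAt v (c * w' 0) (Ici 0) 0 :=
        ((hw.hasDeriv 0 self_mem_Ici).const_mul c).congr hc (hc 0 self_mem_Ici)
      exact (uniqueDiffOn_Ici (0 : ℝ) 0 self_mem_Ici).eq_deriv _ (hv.hasDeriv 0 self_mem_Ici) hd
    obtain ⟨c, h1, h2⟩ := hmul h
    obtain ⟨d, h3, h4⟩ := hmul k
    rw [h1, h2, h3, h4]; ring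
  rcases lt_or_gt_of_ne hz with hz | hz
  · have := key (by simpa using hz) h.star k.star
    have h2 := congrArg conj this
    simpa using h2
  · exact key hz h k

/-! #### Potentials that are essentially bounded below -/

theorem norm_sq_sub_le {a b t s ε : ℝ} (hε : 0 < ε) (hat : a ≤ t) (hts : t ≤ s) (hsb : s ≤ b)
    (h : SolvesOn q z a b u u') :
    |‖u s‖ ^ 2 - ‖u t‖ ^ 2| ≤ ε * (∫ x in a..b, ‖u' x‖ ^ 2) + ε⁻¹ * ∫ x in a..b, ‖u x‖ ^ 2 := by
  have hab : a ≤ b := hat.trans (hts.trans hsb)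
  have e := (h.left.star.mul hab h.left).sub_eq hab hat hts hsb
  simp only [Complex.conj_mul'] at e
  have hu := h.continuousOn hab
  have hu' := h.continuousOn' hab
  have hcont : ContinuousOn (fun x => ε * ‖u' x‖ ^ 2 + ε⁻¹ * ‖u x‖ ^ 2) (Icc a b) := by fun_prop
  have hi : IntervalIntegrable (fun x => ε * ‖u' x‖ ^ 2 + ε⁻¹ * ‖u x‖ ^ 2) volume a b := by
    refine ContinuousOn.intervalIntegrable ?_
    rwa [uIcc_of_le hab]
  have hsub : uIcc t s ⊆ uIcc a b := by
    rw [uIcc_of_le hab, uIcc_of_le hts]; exact Icc_subset_Icc hat hsb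
  have hn : |‖u s‖ ^ 2 - ‖u t‖ ^ 2| = ‖((‖u s‖ : ℂ)) ^ 2 - (‖u t‖ : ℂ) ^ 2‖ := by
    rw [← Complex.ofReal_pow, ← Complex.ofReal_pow, ← Complex.ofReal_sub, Complex.norm_real,
      Real.norm_eq_abs]
  rw [hn, e]
  refine (intervalIntegral.norm_integral_le_of_norm_le hts (Eventually.of_forall fun x _ => ?_)
    (hi.mono_set hsub)).trans ?_
  · refine (norm_add_le _ _).trans ?_
    rw [norm_mul, norm_mul, Complex.norm_conj, Complex.norm_conj]
    have h1 : 0 ≤ ε⁻¹ * (ε * ‖u' x‖ - ‖u x‖) ^ 2 := by positivity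
    have h2 : ε⁻¹ * (ε * ‖u' x‖ - ‖u x‖) ^ 2
        = ε * ‖u' x‖ ^ 2 - 2 * (‖u' x‖ * ‖u x‖) + ε⁻¹ * ‖u x‖ ^ 2 := by field_simp; ring
    linarith
  · refine (intervalIntegral.integral_mono_interval hat hts hsb
      (Eventually.of_forall fun x => by positivity) hi).trans (le_of_eq ?_)
    rw [intervalIntegral.integral_add, intervalIntegral.integral_const_mul,
      intervalIntegral.integral_const_mul]
    all_goals
      refine ContinuousOn.intervalIntegrable ?_
      rw [uIcc_of_le hab]
      fun_prop

theorem norm_sq_le_of_unit_interval {x s ε : ℝ} (hε : 0 < ε) (hs : s ∈ Icc x (x + 1))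
    (h : SolvesOn q z x (x + 1) u u') :
    ‖u s‖ ^ 2 ≤ ε * (∫ t in x..(x + 1), ‖u' t‖ ^ 2)
      + (1 + ε⁻¹) * ∫ t in x..(x + 1), ‖u t‖ ^ 2 := by
  have hx : x ≤ x + 1 := by linarith
  set K := ε * (∫ t in x..(x + 1), ‖u' t‖ ^ 2) + ε⁻¹ * ∫ t in x..(x + 1), ‖u t‖ ^ 2 with hK
  have hi := h.intervalIntegrable_sq hx le_rfl hx le_rfl
  have hle : ∀ t ∈ Icc x (x + 1), ‖u s‖ ^ 2 ≤ ‖u t‖ ^ 2 + K := by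
    intro t ht
    rcases le_total t s with hts | hts
    · have := (le_abs_self _).trans (norm_sq_sub_le hε ht.1 hts hs.2 h)
      linarith
    · have := (neg_le_abs _).trans (norm_sq_sub_le hε hs.1 hts ht.2 h)
      linarith
  have := intervalIntegral.integral_mono_on hx intervalIntegrable_const
    (hi.add intervalIntegrable_const) hle
  rw [intervalIntegral.integral_const, intervalIntegral.integral_add hi intervalIntegrable_const,
    intervalIntegral.integral_const] at this
  simp only [add_sub_cancel_left, one_smul] at this
  linarith

theorem intervalIntegrable_negPart {a b : ℝ} (hq : IntervalIntegrable q volume a b) :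
    IntervalIntegrable (fun x => max (-q x) 0) volume a b :=
  ⟨hq.1.neg.pos_part, hq.2.neg.pos_part⟩

theorem intervalIntegrable_mul_sq {a b : ℝ} {p : ℝ → ℝ} (hab : a ≤ b)
    (hp : IntervalIntegrable p volume a b) (h : SolvesOn q z a b u u') :
    IntervalIntegrable (fun x => p x * ‖u x‖ ^ 2) volume a b := by
  refine hp.mul_continuousOn ?_
  rw [uIcc_of_le hab]
  exact (h.continuousOn hab).norm.pow 2

theorem integral_negPart_le_of_unit_interval {x M : ℝ} (hM : 0 < M)
    (hq : IntervalIntegrable q volume x (x + 1)) (hqM : ∫ y in x..(x + 1), max (-q y) 0 ≤ M)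
    (h : SolvesOn q z x (x + 1) u u') :
    ∫ t in x..(x + 1), max (-q t) 0 * ‖u t‖ ^ 2 ≤ (1 / 2) * (∫ t in x..(x + 1), ‖u' t‖ ^ 2)
      + (M * (1 + 2 * M)) * ∫ t in x..(x + 1), ‖u t‖ ^ 2 := by
  have hx : x ≤ x + 1 := by linarith
  set A := ∫ t in x..(x + 1), ‖u' t‖ ^ 2 with hA
  set B := ∫ t in x..(x + 1), ‖u t‖ ^ 2 with hB
  have hA0 : 0 ≤ A := intervalIntegral.integral_nonneg hx fun _ _ => by positivity
  have hB0 : 0 ≤ B := intervalIntegral.integral_nonneg hx fun _ _ => by positivity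
  have hs : ∀ t ∈ Icc x (x + 1), ‖u t‖ ^ 2 ≤ (2 * M)⁻¹ * A + (1 + 2 * M) * B := by
    intro t ht
    have := norm_sq_le_of_unit_interval (ε := (2 * M)⁻¹) (by positivity) ht h
    rwa [inv_inv] at this
  have hn := intervalIntegrable_negPart hq
  calc ∫ t in x..(x + 1), max (-q t) 0 * ‖u t‖ ^ 2
      ≤ ∫ t in x..(x + 1), max (-q t) 0 * ((2 * M)⁻¹ * A + (1 + 2 * M) * B) := by
        refine intervalIntegral.integral_mono_on hx (intervalIntegrable_mul_sq hx hn h)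
          (hn.mul_const _) fun t ht => ?_
        exact mul_le_mul_of_nonneg_left (hs t ht) (le_max_right _ _)
    _ = (∫ t in x..(x + 1), max (-q t) 0) * ((2 * M)⁻¹ * A + (1 + 2 * M) * B) := by
        rw [intervalIntegral.integral_mul_const]
    _ ≤ M * ((2 * M)⁻¹ * A + (1 + 2 * M) * B) := by gcongr
    _ = _ := by field_simp

theorem intervalIntegrable_halfLine (hq : LocallyIntegrableHalfLine q) {x y : ℝ} (hx : 0 ≤ x)
    (hxy : x ≤ y) : IntervalIntegrable q volume x y := by
  refine (intervalIntegrable_of_Ioo (hx.trans hxy) (hq.integrableOn y)).mono_set ?_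
  rw [uIcc_of_le hxy, uIcc_of_le (hx.trans hxy)]
  exact Icc_subset_Icc_left hx

theorem intervalIntegrable_deriv_sq (h : ∀ c, 0 ≤ c → SolvesOn q z 0 c u u') {x y : ℝ}
    (hx : 0 ≤ x) (hxy : x ≤ y) : IntervalIntegrable (fun t => ‖u' t‖ ^ 2) volume x y := by
  refine ContinuousOn.intervalIntegrable ?_
  rw [uIcc_of_le hxy]
  exact ((continuousOn_Ici' h).mono fun t ht => hx.trans ht.1).norm.pow 2

theorem integral_negPart_le (hq : LocallyIntegrableHalfLine q) {M : ℝ} (hM : 0 < M)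
    (hqM : ∀ x : ℝ, 0 < x → ∫ y in x..(x + 1), max (-q y) 0 ≤ M)
    (h : ∀ c, 0 ≤ c → SolvesOn q z 0 c u u') {x : ℝ} (hx : 0 < x) (n : ℕ) :
    ∫ t in x..(x + n), max (-q t) 0 * ‖u t‖ ^ 2 ≤ (1 / 2) * (∫ t in x..(x + n), ‖u' t‖ ^ 2)
      + (M * (1 + 2 * M)) * ∫ t in x..(x + n), ‖u t‖ ^ 2 := by
  induction n with
  | zero => simp
  | succ n ih =>
    have h0 : 0 < x + n := by positivity
    have h1 : x ≤ x + n := by linarith [n.cast_nonneg (α := ℝ)]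
    have h2 : x + n ≤ x + n + 1 := by linarith
    have e : x + ((n + 1 : ℕ) : ℝ) = x + n + 1 := by push_cast; ring
    have hs : ∀ {a b : ℝ}, 0 ≤ a → a ≤ b → SolvesOn q z a b u u' := fun ha hab =>
      (h _ (ha.trans hab)).mono (ha.trans hab) ha hab le_rfl
    have hneg : ∀ {a b : ℝ}, 0 ≤ a → a ≤ b →
        IntervalIntegrable (fun t => max (-q t) 0 * ‖u t‖ ^ 2) volume a b := fun ha hab =>
      intervalIntegrable_mul_sq hab
        (intervalIntegrable_negPart (intervalIntegrable_halfLine hq ha hab)) (hs ha hab)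
    have hsq : ∀ {a b : ℝ}, 0 ≤ a → a ≤ b →
        IntervalIntegrable (fun t => ‖u t‖ ^ 2) volume a b := fun ha hab =>
      (hs ha hab).intervalIntegrable_sq hab le_rfl hab le_rfl
    have hstep := integral_negPart_le_of_unit_interval hM
      (intervalIntegrable_halfLine hq h0.le h2) (hqM _ h0) (hs h0.le h2)
    rw [e, ← intervalIntegral.integral_add_adjacent_intervals (hneg hx.le h1) (hneg h0.le h2),
      ← intervalIntegral.integral_add_adjacent_intervals (hsq hx.le h1) (hsq h0.le h2),
      ← intervalIntegral.integral_add_adjacent_intervals (intervalIntegrable_deriv_sq h hx.le h1)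
        (intervalIntegrable_deriv_sq h h0.le h2)]
    linarith

/-- The real part of the Green identity. -/
theorem re_sub_re {x y : ℝ} (hxy : x ≤ y) (hq : IntervalIntegrable q volume x y)
    (h : SolvesOn q z x y u u') :
    (conj (u y) * u' y).re - (conj (u x) * u' x).re
      = (∫ t in x..y, ‖u' t‖ ^ 2) + ∫ t in x..y, (q t - z.re) * ‖u t‖ ^ 2 := by
  have hP := h.left.star.mul hxy h.right
  have e := hP.sub_eq hxy le_rfl hxy le_rfl
  have e2 := congrArg Complex.re e
  rw [Complex.sub_re] at e2
  rw [e2]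
  have e3 := Complex.reCLM.intervalIntegral_comp_comm hP.integrable
  simp only [Complex.reCLM_apply] at e3
  have hc' : ContinuousOn (fun t => ‖u' t‖ ^ 2) (Icc x y) := (h.continuousOn' hxy).norm.pow 2
  rw [← e3, ← intervalIntegral.integral_add
    (by refine ContinuousOn.intervalIntegrable ?_; rwa [uIcc_of_le hxy])
    (intervalIntegrable_mul_sq hxy (hq.sub intervalIntegrable_const) h)]
  refine intervalIntegral.integral_congr fun t _ => ?_
  have : conj (u' t) * u' t + conj (u t) * (((q t : ℂ) - z) * u t)
      = ((‖u' t‖ ^ 2 : ℝ) : ℂ) + ((q t : ℂ) - z) * ((‖u t‖ ^ 2 : ℝ) : ℂ) := by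
    push_cast
    rw [← Complex.conj_mul', ← Complex.conj_mul']; ring
  simp only [this]
  rw [Complex.add_re, Complex.ofReal_re, Complex.re_mul_ofReal, Complex.sub_re, Complex.ofReal_re]

theorem not_integrableOn_of_one_le {g : ℝ → ℝ} {a : ℝ} (hg : ∀ x, a < x → 1 ≤ g x) :
    ¬ IntegrableOn g (Ioi a) := by
  intro h
  have h1 : IntegrableOn (fun _ : ℝ => (1 : ℝ)) (Ioi a) := by
    refine Integrable.mono' h aestronglyMeasurable_const ?_
    filter_upwards [self_mem_ae_restrict (μ := volume) (measurableSet_Ioi (a := a))] with x hx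
    simpa using hg x hx
  rw [integrableOn_const_iff] at h1
  simp at h1

/-- If `q` is essentially bounded below then the derivative of a square integrable solution is
square integrable. -/
theorem IsL2Solution.integrableOn_deriv_sq (hq : LocallyIntegrableHalfLine q)
    (hb : EssentiallyBoundedBelow q) (h : IsL2Solution q z u u') :
    IntegrableOn (fun x => ‖u' x‖ ^ 2) (Ioi 2) := by
  obtain ⟨M', hM'⟩ := hb
  set M := max M' 1 with hMdef
  have hM : 0 < M := lt_of_lt_of_le one_pos (le_max_right _ _)
  have hqM : ∀ x : ℝ, 0 < x → ∫ y in x..(x + 1), max (-q y) 0 ≤ M := fun x hx =>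
    (hM' x hx).trans (le_max_left _ _)
  have hs : ∀ {a b : ℝ}, 0 ≤ a → a ≤ b → SolvesOn q z a b u u' := fun ha hab =>
    (h.solves _ (ha.trans hab)).mono (ha.trans hab) ha hab le_rfl
  set S := ∫ t in Ioi (0 : ℝ), ‖u t‖ ^ 2 with hS
  have hSle : ∀ {a b : ℝ}, 0 ≤ a → a ≤ b → ∫ t in a..b, ‖u t‖ ^ 2 ≤ S := by
    intro a b ha hab
    rw [intervalIntegral.integral_of_le hab]
    exact setIntegral_mono_set h.sq (Eventually.of_forall fun _ => by positivity)
      (Eventually.of_forall fun t ht => lt_of_le_of_lt ha ht.1)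
  have hcre : ContinuousOn (fun x => (conj (u x) * u' x).re) (Icc 1 2) := by
    have h1 := (hs (zero_le_one) (one_le_two : (1 : ℝ) ≤ 2)).continuousOn one_le_two
    have h2 := (hs (zero_le_one) (one_le_two : (1 : ℝ) ≤ 2)).continuousOn' one_le_two
    exact Complex.continuous_re.comp_continuousOn
      ((Complex.continuous_conj.comp_continuousOn h1).mul h2)
  obtain ⟨C, hC⟩ := isCompact_Icc.exists_bound_of_continuousOn hcre
  set C₁ := C + (M * (1 + 2 * M) + |z.re|) * S with hC₁
  have key : ∀ y, 2 ≤ y →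
      (1 / 2) * (∫ t in 2..y, ‖u' t‖ ^ 2) ≤ (conj (u y) * u' y).re + C₁ := by
    intro y hy
    set n := ⌊y - 1⌋₊ with hn
    have hn1 : (n : ℝ) ≤ y - 1 := Nat.floor_le (by linarith)
    have hn2 : y - 1 < n + 1 := Nat.lt_floor_add_one _
    set x := y - n with hx
    have hx1 : 1 ≤ x := by linarith
    have hx2 : x ≤ 2 := by linarith
    have hxy : x ≤ y := by linarith
    have hx0 : 0 < x := by linarith
    have hxn : x + n = y := by rw [hx]; ring
    have hneg := integral_negPart_le hq hM hqM h.solves hx0 n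
    rw [hxn] at hneg
    have hqi := intervalIntegrable_halfLine hq hx0.le hxy
    have hre := re_sub_re hxy hqi (hs hx0.le hxy)
    have hCx := hC x ⟨hx1, hx2⟩
    rw [Real.norm_eq_abs] at hCx
    have hCx' := neg_abs_le ((conj (u x) * u' x).re)
    have hsq := (hs hx0.le hxy).intervalIntegrable_sq hxy le_rfl hxy le_rfl
    have hlow : -(∫ t in x..y, max (-q t) 0 * ‖u t‖ ^ 2) - |z.re| * (∫ t in x..y, ‖u t‖ ^ 2)
        ≤ ∫ t in x..y, (q t - z.re) * ‖u t‖ ^ 2 := by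
      have hi1 := intervalIntegrable_mul_sq hxy (intervalIntegrable_negPart hqi) (hs hx0.le hxy)
      have hi2 : IntervalIntegrable (fun t => -(max (-q t) 0 * ‖u t‖ ^ 2)) volume x y := hi1.neg
      rw [← intervalIntegral.integral_neg, ← intervalIntegral.integral_const_mul,
        ← intervalIntegral.integral_sub hi2 (hsq.const_mul _)]
      refine intervalIntegral.integral_mono_on hxy (hi2.sub (hsq.const_mul _))
        (intervalIntegrable_mul_sq hxy (hqi.sub intervalIntegrable_const) (hs hx0.le hxy))
        fun t _ => ?_
      have a1 : -max (-q t) 0 ≤ q t := by linarith [le_max_left (-q t) 0]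
      have a2 := le_abs_self z.re
      have a3 : (-max (-q t) 0 - |z.re|) * ‖u t‖ ^ 2 ≤ (q t - z.re) * ‖u t‖ ^ 2 := by
        gcongr
      linarith
    have hmono : ∫ t in 2..y, ‖u' t‖ ^ 2 ≤ ∫ t in x..y, ‖u' t‖ ^ 2 :=
      intervalIntegral.integral_mono_interval hx2 hy le_rfl
        (Eventually.of_forall fun _ => by positivity)
        (intervalIntegrable_deriv_sq h.solves hx0.le hxy)
    have hSxy := hSle hx0.le hxy
    have hcoef : 0 ≤ M * (1 + 2 * M) + |z.re| := by positivity
    have hfin := mul_le_mul_of_nonneg_left hSxy hcoef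
    linarith
  have hbdd : ∃ B, ∀ y, 2 ≤ y → ∫ t in 2..y, ‖u' t‖ ^ 2 ≤ B := by
    by_contra! hcon
    obtain ⟨Y, hY, hYB⟩ := hcon (2 * (C₁ + 1))
    have hre1 : ∀ y, Y ≤ y → 1 ≤ (conj (u y) * u' y).re := by
      intro y hy
      have h1 := key y (hY.trans hy)
      have h2 : ∫ t in 2..Y, ‖u' t‖ ^ 2 ≤ ∫ t in 2..y, ‖u' t‖ ^ 2 :=
        intervalIntegral.integral_mono_interval le_rfl hY hy
          (Eventually.of_forall fun _ => by positivity)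
          (intervalIntegrable_deriv_sq h.solves zero_le_two (hY.trans hy))
      linarith
    have hY0 : 0 ≤ Y := by linarith
    refine not_integrableOn_of_one_le (g := fun x => ‖u x‖ ^ 2) (a := Y + 1) (fun y hy => ?_)
      (h.sq.mono_set (Ioi_subset_Ioi (by linarith)))
    have hYy : Y ≤ y := by linarith
    have hsol := hs hY0 hYy
    have hP := hsol.left.star.mul hYy hsol.left
    have e := hP.sub_eq hYy le_rfl hYy le_rfl
    have e2 := congrArg Complex.re e
    have e3 := Complex.reCLM.intervalIntegral_comp_comm hP.integrable
    simp only [Complex.reCLM_apply] at e3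
    rw [← e3] at e2
    simp only [Complex.conj_mul', ← Complex.ofReal_pow, ← Complex.ofReal_sub,
      Complex.ofReal_re] at e2
    have hge : ∫ t in Y..y, (1 : ℝ)
        ≤ ∫ t in Y..y, (conj (u' t) * u t + conj (u t) * u' t).re := by
      refine intervalIntegral.integral_mono_on hYy intervalIntegrable_const
        ⟨hP.integrable.1.re, hP.integrable.2.re⟩ fun t ht => ?_
      have h1 := hre1 t ht.1
      have h2 : (conj (u' t) * u t).re = (conj (u t) * u' t).re := by
        simp only [Complex.mul_re, Complex.conj_re, Complex.conj_im]; ring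
      rw [Complex.add_re, h2]
      linarith
    rw [intervalIntegral.integral_const, smul_eq_mul, mul_one, ← e2] at hge
    nlinarith [sq_nonneg ‖u Y‖]
  obtain ⟨B, hB⟩ := hbdd
  refine integrableOn_Ioi_of_intervalIntegral_norm_bounded B 2
    (b := fun n : ℕ => (n : ℝ)) (fun n => ?_) tendsto_natCast_atTop_atTop ?_
  · rcases le_total (2 : ℝ) n with hn | hn
    · rw [← intervalIntegrable_iff_integrableOn_Ioc_of_le hn]
      exact intervalIntegrable_deriv_sq h.solves zero_le_two hn
    · rw [Ioc_eq_empty (not_lt.2 hn)]; exact integrableOn_empty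
  · filter_upwards [eventually_ge_atTop 2] with n hn
    simpa using hB n (by exact_mod_cast hn)

theorem EssentiallyBoundedBelow.wronskian_eq_zero (hq : LocallyIntegrableHalfLine q)
    (hb : EssentiallyBoundedBelow q) (h : IsL2Solution q z u u') (k : IsL2Solution q z v v') :
    u 0 * v' 0 - u' 0 * v 0 = 0 := by
  have hsub : Ioi (2 : ℝ) ⊆ Ioi 0 := Ioi_subset_Ioi zero_le_two
  have h1 := integrableOn_mul_of_sq zero_le_two (continuousOn_Ici h.solves)
    (continuousOn_Ici' k.solves) (h.sq.mono_set hsub) (k.integrableOn_deriv_sq hq hb)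
  have h2 := integrableOn_mul_of_sq zero_le_two (continuousOn_Ici' h.solves)
    (continuousOn_Ici k.solves) (h.integrableOn_deriv_sq hq hb) (k.sq.mono_set hsub)
  have h3 : IntegrableOn (fun _ : ℝ => u 0 * v' 0 - u' 0 * v 0) (Ioi 2) := by
    refine (h1.sub h2).congr ?_
    filter_upwards [self_mem_ae_restrict (μ := volume) (measurableSet_Ioi (a := (2 : ℝ)))]
      with x hx
    have hx0 : 0 ≤ x := zero_le_two.trans (le_of_lt hx)
    exact (h.solves x hx0).wronskian_const hx0 (k.solves x hx0) ⟨hx0, le_rfl⟩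
  rw [integrableOn_const_iff] at h3
  simpa using h3

theorem exists_weylGenerator_squareIntegrable (he : Endpoint.squareIntegrable.Admissible q)
    (hz : z.im ≠ 0) : ∃ ψ ψ', IsWeylGenerator q .squareIntegrable z ψ ψ' := by
  obtain ⟨ψ, ψ', h, h0, him⟩ := exists_isL2Solution he.1 hz
  refine ⟨ψ, ψ', ⟨isSolution_Ici h.solves, ⟨0, self_mem_Ici, by simp [h0]⟩, h.isL2AtInfinity⟩,
    fun x hx => him x hx, fun v v' hv => ?_⟩
  have k : IsL2Solution q z v v' :=
    isL2Solution_of_isL2AtInfinity (fun c hc => hv.1.solvesOn_Ici he.1 hc) hv.2.2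
  rcases he.2 with hb | hp
  · exact hb.wronskian_eq_zero he.1 h k
  · exact hp.wronskian_eq_zero hz h k

/-! #### Limit circle -/

theorem IsLimitCircle.isL2Solution (hc : IsLimitCircle q) (hz : z.im ≠ 0)
    (h : ∀ c, 0 ≤ c → SolvesOn q z 0 c u u') : IsL2Solution q z u u' := by
  refine isL2Solution_of_isL2AtInfinity h ?_
  rcases lt_or_gt_of_ne hz with hz | hz
  · obtain ⟨R, hR, hi⟩ := hc (conj z) (by simpa using hz) _ _
      (isSolution_Ici fun c hc => (h c hc).star)
    exact ⟨R, hR, by simpa using hi⟩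
  · exact hc z hz u u' (isSolution_Ici h)

theorem tendsto_wronskian_of_tendsto {u₀ u₀' : ℝ → ℂ} (hq : LocallyIntegrableHalfLine q)
    (hc : IsLimitCircle q) (h₀ : IsL2Solution q Complex.I u₀ u₀')
    (hne : u₀ 0 ≠ 0 ∨ u₀' 0 ≠ 0) (hu : IsL2Solution q z₁ u u') (hv : IsL2Solution q z₂ v v')
    (h1 : Tendsto (fun x => u₀ x * u' x - u₀' x * u x) atTop (𝓝 0))
    (h2 : Tendsto (fun x => u₀ x * v' x - u₀' x * v x) atTop (𝓝 0)) :
    Tendsto (fun x => u x * v' x - u' x * v x) atTop (𝓝 0) := by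
  obtain ⟨w, w', w0, w0', hw⟩ :=
    exists_solvesOn_halfLine hq Complex.I (-conj (u₀' 0)) (conj (u₀ 0))
  have hwL := hc.isL2Solution (by simp) hw
  obtain ⟨l₁, hl₁⟩ := hv.exists_tendsto_wronskian hwL
  obtain ⟨l₂, hl₂⟩ := hwL.exists_tendsto_wronskian hu
  set K := u₀ 0 * w' 0 - u₀' 0 * w 0 with hK
  have hK0 : K ≠ 0 := by
    have e : K = ((‖u₀ 0‖ ^ 2 + ‖u₀' 0‖ ^ 2 : ℝ) : ℂ) := by
      rw [hK, w0, w0']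
      push_cast
      rw [← Complex.mul_conj', ← Complex.mul_conj']; ring
    rw [e]
    norm_cast
    rcases hne with h | h
    · have := norm_pos_iff.2 h; positivity
    · have := norm_pos_iff.2 h; positivity
  have ht := ((h1.mul hl₁).add (h2.mul hl₂)).const_mul (-K⁻¹)
  simp only [zero_mul, add_zero, mul_zero] at ht
  refine ht.congr' ?_
  filter_upwards [eventually_ge_atTop 0] with x hx
  have hKx := (h₀.solves x hx).wronskian_const hx (hw x hx) ⟨hx, le_rfl⟩
  rw [← hK] at hKx
  have e : (u₀ x * u' x - u₀' x * u x) * (v x * w' x - v' x * w x)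
      + (u₀ x * v' x - u₀' x * v x) * (w x * u' x - w' x * u x)
      = -K * (u x * v' x - u' x * v x) := by rw [← hKx]; ring
  rw [e]
  field_simp

theorem tendsto_wronskian_conj {u₀ u₀' : ℝ → ℂ}
    (hsa : Tendsto (fun x => (conj (u₀ x) * u₀' x).im) atTop (𝓝 0))
    (hu : IsL2Solution q z u u')
    (h1 : Tendsto (fun x => u₀ x * u' x - u₀' x * u x) atTop (𝓝 0)) :
    Tendsto (fun x => u₀ x * conj (u' x) - u₀' x * conj (u x)) atTop (𝓝 0) := by
  obtain ⟨l, hl⟩ := hu.exists_tendsto_wronskian hu.star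
  have h2 : Tendsto (fun x => u₀ x * conj (u₀' x) - u₀' x * conj (u₀ x)) atTop (𝓝 0) := by
    have := ((Complex.continuous_ofReal.tendsto 0).comp hsa).const_mul (-2 * Complex.I)
    simp only [Complex.ofReal_zero, mul_zero] at this
    refine this.congr fun x => ?_
    apply Complex.ext <;> simp <;> ring
  have h3 : Tendsto (fun x => conj (u₀ x * u' x - u₀' x * u x)) atTop (𝓝 0) := by
    have := (Complex.continuous_conj.tendsto 0).comp h1
    rwa [map_zero] at this
  have h4 := ((h2.mul hl).sub (h1.mul h3)).norm.sqrt
  simp only [zero_mul, mul_zero, sub_zero, norm_zero, Real.sqrt_zero] at h4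
  rw [tendsto_zero_iff_norm_tendsto_zero]
  refine h4.congr fun x => ?_
  have e : (u₀ x * conj (u₀' x) - u₀' x * conj (u₀ x)) * (u x * conj (u' x) - u' x * conj (u x))
      - (u₀ x * u' x - u₀' x * u x) * conj (u₀ x * u' x - u₀' x * u x)
      = -((u₀ x * conj (u' x) - u₀' x * conj (u x))
        * conj (u₀ x * conj (u' x) - u₀' x * conj (u x))) := by
    simp only [map_sub, map_mul, Complex.conj_conj]; ring
  rw [e, norm_neg, norm_mul, Complex.norm_conj, Real.sqrt_mul_self (norm_nonneg _)]

theorem exists_weylGenerator_limitCircle {u₀ u₀' : ℝ → ℂ}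
    (he : (Endpoint.limitCircle u₀ u₀').Admissible q) (hz : z.im ≠ 0) :
    ∃ ψ ψ', IsWeylGenerator q (.limitCircle u₀ u₀') z ψ ψ' := by
  obtain ⟨hq, hc, hs₀, hn₀, hsa⟩ := id he
  have hne := initial_ne_zero he hs₀ hn₀
  have h₀ : IsL2Solution q Complex.I u₀ u₀' :=
    hc.isL2Solution (by simp) fun c hc => hs₀.solvesOn_Ici hq hc
  obtain ⟨θ, θ', t0, t0', hθ⟩ := exists_solvesOn_halfLine hq z 1 0
  obtain ⟨φ, φ', p0, p0', hφ⟩ := exists_solvesOn_halfLine hq z 0 1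
  obtain ⟨A, hA⟩ := h₀.exists_tendsto_wronskian (hc.isL2Solution hz hθ)
  obtain ⟨B, hB⟩ := h₀.exists_tendsto_wronskian (hc.isL2Solution hz hφ)
  obtain ⟨α, β, hαβ, hlin⟩ : ∃ α β : ℂ, (α ≠ 0 ∨ β ≠ 0) ∧ α * A + β * B = 0 := by
    by_cases hA0 : A = 0
    · exact ⟨1, 0, by simp, by simp [hA0]⟩
    · exact ⟨B, -A, Or.inr (neg_ne_zero.2 hA0), by ring⟩
  set ψ : ℝ → ℂ := fun x => α * θ x + β * φ x with hψdef
  set ψ' : ℝ → ℂ := fun x => α * θ' x + β * φ' x with hψdef'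
  have hψ : ∀ c, 0 ≤ c → SolvesOn q z 0 c ψ ψ' := fun c hc =>
    ((hθ c hc).const_mul α).add hc ((hφ c hc).const_mul β)
  have hψL := hc.isL2Solution hz hψ
  have hψt : Tendsto (fun x => u₀ x * ψ' x - u₀' x * ψ x) atTop (𝓝 0) := by
    have := (hA.const_mul α).add (hB.const_mul β)
    rw [hlin] at this
    refine this.congr fun x => ?_
    simp only [hψdef, hψdef']; ring
  have hψ0 : ψ 0 ≠ 0 ∨ ψ' 0 ≠ 0 := by simpa [hψdef, hψdef', t0, t0', p0, p0'] using hαβ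
  have hsol := isSolution_Ici hψ
  refine ⟨ψ, ψ', ⟨hsol, isNonzeroOn_of_initial (uniqueDiffOn_Ici 0) self_mem_Ici hsol hψ0, hψt⟩,
    fun x hx => ?_, fun v v' hv => ?_⟩
  · have hx0 : 0 ≤ x := hx
    have hW := tendsto_wronskian_of_tendsto hq hc h₀ hne hψL.star hψL
      (tendsto_wronskian_conj hsa hψL hψt) hψt
    have him : Tendsto (fun y => (conj (ψ y) * ψ' y).im * z.im) atTop (𝓝 0) := by
      have := ((Complex.continuous_im.tendsto 0).comp hW).mul_const (z.im / 2)
      simp only [Complex.zero_im, zero_mul] at this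
      refine this.congr fun y => ?_
      simp only [Function.comp_apply, Complex.sub_im, Complex.mul_im, Complex.conj_re,
        Complex.conj_im]
      ring
    refine le_of_tendsto him ?_
    filter_upwards [eventually_ge_atTop x] with y hy
    have hy0 := hx0.trans hy
    have hE := (hψ y hy0).im_sub_im hy0 hx0 hy le_rfl
    have hI : 0 ≤ ∫ t in x..y, ‖ψ t‖ ^ 2 :=
      intervalIntegral.integral_nonneg hy fun t _ => by positivity
    have := mul_nonneg (mul_self_nonneg z.im) hI
    linear_combination this + z.im * hE
  · have hv1 : ∀ c, 0 ≤ c → SolvesOn q z 0 c v v' := fun c hc => hv.1.solvesOn_Ici hq hc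
    have hW := tendsto_wronskian_of_tendsto hq hc h₀ hne hψL (hc.isL2Solution hz hv1) hψt hv.2.2
    refine tendsto_nhds_unique (tendsto_const_nhds.congr' ?_) hW
    filter_upwards [eventually_ge_atTop 0] with x hx
    exact ((hψ x hx).wronskian_const hx (hv1 x hx) ⟨hx, le_rfl⟩).symm

theorem exists_weylGenerator {e : Endpoint} (he : e.Admissible q) (hz : z.im ≠ 0) :
    ∃ ψ ψ', IsWeylGenerator q e z ψ ψ' := by
  cases e with
  | regular b h => exact exists_weylGenerator_regular he z
  | squareIntegrable => exact exists_weylGenerator_squareIntegrable he hz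
  | limitCircle u₀ u₀' => exact exists_weylGenerator_limitCircle he hz

end

/-! ### Comparison of two Weyl-Titchmarsh functions -/

section

variable {q q₁ q₂ : ℝ → ℝ} {z κ : ℂ} {a δ η : ℝ} {e e₁ e₂ : Endpoint} {ψ ψ' : ℝ → ℂ}

theorem integral_le_of_localL1Sup_le (hδ : 0 ≤ δ) (hq : IntegrableOn q (Ioo 0 (a + δ)))
    (h : localL1Sup a δ q ≤ η) {x : ℝ} (hx : x ∈ Icc 0 a) : ∫ y in x..(x + δ), |q y| ≤ η := by
  refine h.trans' (le_csSup ?_ ⟨x, hx, rfl⟩)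
  have hL : 0 ≤ a + δ := add_nonneg (hx.1.trans hx.2) hδ
  refine ⟨∫ y in 0..(a + δ), |q y|, ?_⟩
  rintro _ ⟨y, hy, rfl⟩
  exact intervalIntegral.integral_mono_interval hy.1 (by linarith) (by linarith [hy.2])
    (Eventually.of_forall fun _ => abs_nonneg _) (intervalIntegrable_of_Ioo hL hq).abs

theorem integral_abs_le (ha : 0 ≤ a) (hδ : 0 < δ) (hη0 : 0 ≤ η)
    (hq : IntegrableOn q (Ioo 0 (a + δ)))
    (hη : ∀ x ∈ Icc 0 a, ∫ y in x..(x + δ), |q y| ≤ η) :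
    ∫ y in 0..(a + δ), |q y| ≤ (a / δ + 2) * η := by
  have hL : 0 ≤ a + δ := by linarith
  have hi : ∀ {x y : ℝ}, 0 ≤ x → x ≤ y → y ≤ a + δ →
      IntervalIntegrable (fun t => |q t|) volume x y := fun hx hxy hy => by
    refine ((intervalIntegrable_of_Ioo hL hq).mono_set ?_).abs
    rw [uIcc_of_le hxy, uIcc_of_le hL]
    exact Icc_subset_Icc hx hy
  have hn : ∀ n : ℕ, n * δ ≤ a → ∫ y in 0..(n * δ), |q y| ≤ n * η := by
    intro n
    induction n with
    | zero => simp
    | succ n ih =>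
      intro hna
      push_cast at hna ⊢
      have h0 : 0 ≤ n * δ := by positivity
      have e : ((n : ℝ) + 1) * δ = n * δ + δ := by ring
      rw [e] at hna ⊢
      rw [← intervalIntegral.integral_add_adjacent_intervals (hi le_rfl h0 (by linarith))
        (hi h0 (by linarith) (by linarith))]
      have h1 := ih (by linarith)
      have h2 := hη (n * δ) ⟨h0, by linarith⟩
      linarith
  set n := ⌊a / δ⌋₊ with hndef
  have hn1 : (n : ℝ) ≤ a / δ := Nat.floor_le (by positivity)
  have hn2 : a / δ < n + 1 := Nat.lt_floor_add_one _
  have hn1' : n * δ ≤ a := by rwa [le_div_iff₀ hδ] at hn1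
  have hn2' : a < n * δ + δ := by
    rw [div_lt_iff₀ hδ] at hn2; linarith
  have h0 : 0 ≤ n * δ := by positivity
  have h1 := hn n hn1'
  have h2 : ∫ y in (n * δ)..a, |q y| ≤ η :=
    (intervalIntegral.integral_mono_interval le_rfl hn1' hn2'.le
      (Eventually.of_forall fun _ => abs_nonneg _)
      (hi h0 (by linarith) (by linarith))).trans (hη _ ⟨h0, hn1'⟩)
  have h3 := hη a ⟨ha, le_rfl⟩
  rw [← intervalIntegral.integral_add_adjacent_intervals (hi le_rfl ha (by linarith))
    (hi ha (by linarith) le_rfl),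
    ← intervalIntegral.integral_add_adjacent_intervals (hi le_rfl h0 (by linarith))
    (hi h0 hn1' (by linarith))]
  have h4 : n * η ≤ a / δ * η := by gcongr
  linarith

/-- The logarithmic derivative of a Weyl solution is close to `-κ` at a distance from the
endpoint. -/
theorem IsWeylGenerator.logDeriv_add_le (he : e.Admissible q) (hδ : 0 < δ)
    (hr : ((a + δ : ℝ) : EReal) ≤ e.right)
    (hη : ∀ x ∈ Icc 0 a, ∫ y in x..(x + δ), |q y| ≤ η) (hk : 4 * η ≤ κ.re)
    (hkδ : δ⁻¹ * Real.log 6 ≤ κ.re) (him : κ.im ≠ 0)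
    (hψ : IsWeylGenerator q e (-κ ^ 2) ψ ψ') {x : ℝ} (hx : x ∈ Icc 0 a) :
    ψ x ≠ 0 ∧ ‖ψ' x / ψ x + κ‖ ≤ 2 * (∫ y in 0..δ, Real.exp (-2 * κ.re * y) * |q (x + y)|)
      + 864 / 5 * (‖κ‖ ^ 2 / |κ.im|) * Real.exp (-2 * δ * κ.re) := by
  have hxδ : 0 ≤ x + δ := by linarith [hx.1]
  have hmem : x + δ ∈ e.interval := Endpoint.mem_interval_of_le hxδ
    (le_trans (EReal.coe_le_coe_iff.2 (by linarith [hx.2])) hr)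
  have hs := hψ.isWeyl.1.solvesOn he hmem
  have hne := hs.ne_zero_at hxδ (e.integrableOn he hmem)
    (initial_ne_zero he hψ.isWeyl.1 hψ.isWeyl.2.1)
  have hs' : SolvesOn q (-κ ^ 2) (x + 0) (x + δ) ψ ψ' :=
    hs.mono hxδ (by linarith [hx.1]) (by linarith) le_rfl
  have hq : IntegrableOn (fun y => q (x + y)) (Ioo 0 δ) := by
    have h1 : IntervalIntegrable q volume x (x + δ) := by
      refine (intervalIntegrable_of_Ioo hxδ (e.integrableOn he hmem)).mono_set ?_
      rw [uIcc_of_le (by linarith : x ≤ x + δ), uIcc_of_le hxδ]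
      exact Icc_subset_Icc_left hx.1
    have h2 := h1.comp_add_left x
    rw [sub_self, add_sub_cancel_left] at h2
    rwa [intervalIntegrable_iff_integrableOn_Ioo_of_le hδ.le] at h2
  have hη' : ∫ y in 0..δ, |q (x + y)| ≤ η := by
    rw [intervalIntegral.integral_comp_add_left (fun y => |q y|), add_zero]
    exact hη x hx
  have := Schrodinger.logDeriv_add_le hδ hq hη' hk hkδ him (hs'.comp_add x)
    (hψ.im_nonneg _ hmem) hne
  simpa using this

/-- Growth of a solution in terms of its logarithmic derivative. -/
theorem SolvesOn.norm_le_exp {B : ℝ → ℝ} (ha : 0 ≤ a) (h : SolvesOn q z 0 a ψ ψ')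
    (hne : ∀ x ∈ Icc 0 a, ψ x ≠ 0) (hB : ∀ x ∈ Icc 0 a, ‖ψ' x / ψ x + κ‖ ≤ B x)
    (hBi : IntervalIntegrable B volume 0 a) :
    ‖ψ a‖ ≤ ‖ψ 0‖ * Real.exp (-a * κ.re + ∫ x in 0..a, B x) := by
  have hmc : ContinuousOn (fun x => ψ' x / ψ x) (Icc 0 a) :=
    (h.continuousOn' ha).div (h.continuousOn ha) hne
  set m : ℝ → ℂ := IccExtend ha ((Icc 0 a).domRestrict fun x => ψ' x / ψ x) with hm
  have hmcont : Continuous m := (continuousOn_iff_continuous_domRestrict.1 hmc).Icc_extend'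
  have hmeq : ∀ x ∈ Icc 0 a, m x = ψ' x / ψ x := fun x hx => by
    rw [hm, IccExtend_of_mem ha _ hx]; rfl
  have hE : IsPrimitiveOn (fun x => Complex.exp (-∫ t in 0..x, m t))
      (fun x => Complex.exp (-∫ t in 0..x, m t) * -m x) 0 a := by
    have hd : ∀ x, HasDerivAt (fun x => ∫ t in 0..x, m t) (m x) x := fun x =>
      (hmcont.integral_hasStrictDerivAt 0 x).hasDerivAt
    refine IsPrimitiveOn.of_hasDerivAt (fun x => (hd x).neg.cexp) ?_
    have hc : Continuous fun x => ∫ t in 0..x, m t :=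
      continuous_iff_continuousAt.2 fun x => (hd x).continuousAt
    fun_prop
  have hP := (h.left.mul ha hE).congr_right (g' := fun _ => 0) ha fun x hx => by
    rw [hmeq x hx]
    have := hne x hx
    field_simp
    ring
  have hconst := hP.eq_of_deriv_zero ⟨ha, le_rfl⟩
  simp only [intervalIntegral.integral_same, neg_zero, Complex.exp_zero, mul_one] at hconst
  rw [← hconst, norm_mul, mul_assoc, Complex.norm_exp, ← Real.exp_add]
  refine le_mul_of_one_le_right (norm_nonneg _) (Real.one_le_exp ?_)
  have hre : (∫ t in 0..a, m t).re = ∫ t in 0..a, (m t).re := by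
    simpa using (Complex.reCLM.intervalIntegral_comp_comm
      (hmcont.intervalIntegrable 0 a)).symm
  have hle : ∫ t in 0..a, (m t).re ≤ ∫ t in 0..a, (-κ.re + B t) := by
    refine intervalIntegral.integral_mono_on ha
      ((Complex.continuous_re.comp hmcont).intervalIntegrable 0 a)
      (intervalIntegrable_const.add hBi) fun t ht => ?_
    have h1 := (Complex.re_le_norm _).trans (hB t ht)
    rw [hmeq t ht]
    rw [Complex.add_re] at h1
    linarith
  rw [intervalIntegral.integral_add intervalIntegrable_const hBi,
    intervalIntegral.integral_const, smul_eq_mul] at hle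
  rw [Complex.neg_re, hre]
  linarith

theorem norm_logDeriv_sub_le {ψ₁ ψ₁' ψ₂ ψ₂' : ℝ → ℂ} {B₁ B₂ : ℝ → ℝ} {T S : ℝ} (ha : 0 ≤ a)
    (hq : ∀ᵐ x ∂volume.restrict (Icc 0 a), q₁ x = q₂ x)
    (h₁ : SolvesOn q₁ z 0 a ψ₁ ψ₁') (h₂ : SolvesOn q₂ z 0 a ψ₂ ψ₂')
    (hne₁ : ∀ x ∈ Icc 0 a, ψ₁ x ≠ 0) (hne₂ : ∀ x ∈ Icc 0 a, ψ₂ x ≠ 0)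
    (hB₁ : ∀ x ∈ Icc 0 a, ‖ψ₁' x / ψ₁ x + κ‖ ≤ B₁ x)
    (hB₂ : ∀ x ∈ Icc 0 a, ‖ψ₂' x / ψ₂ x + κ‖ ≤ B₂ x)
    (hi₁ : IntervalIntegrable B₁ volume 0 a) (hi₂ : IntervalIntegrable B₂ volume 0 a)
    (hS₁ : ∫ x in 0..a, B₁ x ≤ S) (hS₂ : ∫ x in 0..a, B₂ x ≤ S)
    (hT₁ : ‖ψ₁' a / ψ₁ a + κ‖ ≤ T) (hT₂ : ‖ψ₂' a / ψ₂ a + κ‖ ≤ T) :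
    ‖ψ₁' 0 / ψ₁ 0 - ψ₂' 0 / ψ₂ 0‖ ≤ 2 * T * Real.exp (-2 * a * κ.re + 2 * S) := by
  have h0 : (0 : ℝ) ∈ Icc 0 a := ⟨le_rfl, ha⟩
  have hA : a ∈ Icc 0 a := ⟨ha, le_rfl⟩
  have n1 := hne₁ 0 h0
  have n2 := hne₂ 0 h0
  have n3 := hne₁ a hA
  have n4 := hne₂ a hA
  have hW := (h₂.wronskian_const ha (h₁.congr_potential ha hq) hA)
  have e : ψ₁' 0 / ψ₁ 0 - ψ₂' 0 / ψ₂ 0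
      = (ψ₁' a / ψ₁ a - ψ₂' a / ψ₂ a) * (ψ₁ a / ψ₁ 0) * (ψ₂ a / ψ₂ 0) := by
    have e1 : ψ₁' 0 / ψ₁ 0 - ψ₂' 0 / ψ₂ 0
        = (ψ₂ 0 * ψ₁' 0 - ψ₂' 0 * ψ₁ 0) / (ψ₁ 0 * ψ₂ 0) := by field_simp
    rw [e1, ← hW]
    field_simp
  have hd : ‖ψ₁' a / ψ₁ a - ψ₂' a / ψ₂ a‖ ≤ 2 * T := by
    have : ψ₁' a / ψ₁ a - ψ₂' a / ψ₂ a = (ψ₁' a / ψ₁ a + κ) - (ψ₂' a / ψ₂ a + κ) := by ring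
    rw [this]
    refine (norm_sub_le _ _).trans ?_
    linarith
  have g1 : ‖ψ₁ a / ψ₁ 0‖ ≤ Real.exp (-a * κ.re + S) := by
    rw [norm_div, div_le_iff₀ (norm_pos_iff.2 n1), mul_comm]
    refine (h₁.norm_le_exp ha hne₁ hB₁ hi₁).trans ?_
    gcongr
  have g2 : ‖ψ₂ a / ψ₂ 0‖ ≤ Real.exp (-a * κ.re + S) := by
    rw [norm_div, div_le_iff₀ (norm_pos_iff.2 n2), mul_comm]
    refine (h₂.norm_le_exp ha hne₂ hB₂ hi₂).trans ?_
    gcongr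
  rw [e, norm_mul, norm_mul]
  have hexp : Real.exp (-2 * a * κ.re + 2 * S)
      = Real.exp (-a * κ.re + S) * Real.exp (-a * κ.re + S) := by
    rw [← Real.exp_add]; ring_nf
  rw [hexp, ← mul_assoc]
  have hT0 : 0 ≤ 2 * T := (norm_nonneg _).trans hd
  gcongr

/-- `exp (2 k x) ∫_x^L exp (-2 k y) |q y| dy`. -/
def tailWeight (q : ℝ → ℝ) (k L x : ℝ) : ℝ :=
  Real.exp (2 * k * x) * ∫ y in x..L, Real.exp (-2 * k * y) * |q y|

theorem intervalIntegrable_exp_mul_abs {k x y L : ℝ} (hq : IntervalIntegrable q volume 0 L)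
    (hx : 0 ≤ x) (hxy : x ≤ y) (hy : y ≤ L) :
    IntervalIntegrable (fun y => Real.exp (-2 * k * y) * |q y|) volume x y := by
  refine IntervalIntegrable.continuousOn_mul (IntervalIntegrable.abs (hq.mono_set ?_))
    (by fun_prop : Continuous fun y => Real.exp (-2 * k * y)).continuousOn
  rw [uIcc_of_le hxy, uIcc_of_le (hx.trans (hxy.trans hy))]
  exact Icc_subset_Icc hx hy

theorem integral_exp_shift_le {k x L : ℝ} (hδ : 0 ≤ δ) (hx : 0 ≤ x) (hxL : x + δ ≤ L)
    (hq : IntervalIntegrable q volume 0 L) :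
    ∫ y in 0..δ, Real.exp (-2 * k * y) * |q (x + y)| ≤ tailWeight q k L x := by
  have e : ∀ y, Real.exp (-2 * k * y) * |q (x + y)|
      = Real.exp (2 * k * x) * (Real.exp (-2 * k * (x + y)) * |q (x + y)|) := fun y => by
    rw [← mul_assoc, ← Real.exp_add]; ring_nf
  simp only [e]
  rw [intervalIntegral.integral_const_mul,
    intervalIntegral.integral_comp_add_left (fun y => Real.exp (-2 * k * y) * |q y|), add_zero,
    tailWeight]
  refine mul_le_mul_of_nonneg_left ?_ (Real.exp_pos _).le
  exact intervalIntegral.integral_mono_interval le_rfl (by linarith) hxL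
    (Eventually.of_forall fun _ => by positivity)
    (intervalIntegrable_exp_mul_abs hq hx (by linarith) le_rfl)

theorem tailWeight_nonneg {k L x : ℝ} (hx : x ≤ L) : 0 ≤ tailWeight q k L x :=
  mul_nonneg (Real.exp_pos _).le
    (intervalIntegral.integral_nonneg hx fun _ _ => by positivity)

/-- The weight `tailWeight` is integrable on `[0, a]` with a small integral for large `k`. -/
theorem integral_tailWeight_le {k L : ℝ} (hk : 0 < k) (ha : 0 ≤ a) (haL : a ≤ L)
    (hq : IntervalIntegrable q volume 0 L) :
    IntervalIntegrable (tailWeight q k L) volume 0 a ∧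
      ∫ x in 0..a, tailWeight q k L x ≤ (2 * k)⁻¹ * ∫ y in 0..L, |q y| := by
  have hL : 0 ≤ L := ha.trans haL
  have hsub : ∀ {x y : ℝ}, 0 ≤ x → x ≤ y → y ≤ L →
      IntervalIntegrable (fun t => |q t|) volume x y := fun hx hxy hy => by
    refine (hq.mono_set ?_).abs
    rw [uIcc_of_le hxy, uIcc_of_le hL]
    exact Icc_subset_Icc hx hy
  have hofReal : ∀ {g : ℝ → ℝ} {x y : ℝ}, IntervalIntegrable g volume x y →
      IntervalIntegrable (fun t => (g t : ℂ)) volume x y := fun h => ⟨h.1.ofReal, h.2.ofReal⟩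
  have hg := intervalIntegrable_exp_mul_abs (k := k) hq le_rfl hL le_rfl
  set I : ℂ := ∫ y in 0..L, ((Real.exp (-2 * k * y) * |q y| : ℝ) : ℂ) with hI
  have hc : IsPrimitiveOn (fun x => I - ∫ y in 0..x, ((Real.exp (-2 * k * y) * |q y| : ℝ) : ℂ))
      (fun x => 0 - ((Real.exp (-2 * k * x) * |q x| : ℝ) : ℂ)) 0 L :=
    (IsPrimitiveOn.of_hasDerivAt (fun x => hasDerivAt_const x I) continuous_const).sub hL
      ⟨hofReal hg, fun x _ => by simp⟩
  have hP := (isPrimitiveOn_cexp (2 * k) 0 L).mul hL hc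
  have htw : ∀ x ∈ Icc 0 L, Complex.exp (2 * k * x)
      * (I - ∫ y in 0..x, ((Real.exp (-2 * k * y) * |q y| : ℝ) : ℂ))
      = (tailWeight q k L x : ℂ) := by
    intro x hx
    have hs := intervalIntegral.integral_add_adjacent_intervals
      (hofReal (intervalIntegrable_exp_mul_abs (k := k) hq le_rfl hx.1 hx.2))
      (hofReal (intervalIntegrable_exp_mul_abs (k := k) hq hx.1 hx.2 le_rfl))
    rw [hI, ← hs, add_sub_cancel_left, intervalIntegral.integral_ofReal, tailWeight]
    push_cast
    rfl
  have hT : IsPrimitiveOn (fun x => (tailWeight q k L x : ℂ))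
      (fun x => ((2 * k * tailWeight q k L x - |q x| : ℝ) : ℂ)) 0 L := by
    refine (hP.congr_right hL fun x hx => ?_).congr_left hL fun x hx => (htw x hx).symm
    have h1 := htw x hx
    have h2 : Complex.exp (2 * k * x) * ((Real.exp (-2 * k * x) : ℝ) : ℂ) = 1 := by
      rw [Complex.ofReal_exp, ← Complex.exp_add]; simp
    push_cast at h1 h2 ⊢
    linear_combination (2 * (k : ℂ)) * h1 - ((|q x| : ℝ) : ℂ) * h2
  have hcont : ContinuousOn (tailWeight q k L) (Icc 0 L) := by
    have := Complex.continuous_re.comp_continuousOn (hT.continuousOn hL)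
    exact this
  have hti : IntervalIntegrable (tailWeight q k L) volume 0 a := by
    refine ContinuousOn.intervalIntegrable ?_
    rw [uIcc_of_le ha]
    exact hcont.mono (Icc_subset_Icc_right haL)
  refine ⟨hti, ?_⟩
  have hsub_eq := hT.sub_eq hL le_rfl ha haL
  rw [intervalIntegral.integral_ofReal, ← Complex.ofReal_sub, Complex.ofReal_inj,
    intervalIntegral.integral_sub (hti.const_mul _) (hsub le_rfl ha haL),
    intervalIntegral.integral_const_mul] at hsub_eq
  have h0 := tailWeight_nonneg (q := q) (k := k) (L := L) hL
  have ha' : tailWeight q k L a ≤ ∫ y in a..L, |q y| := by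
    rw [tailWeight, ← intervalIntegral.integral_const_mul]
    refine intervalIntegral.integral_mono_on haL
      ((intervalIntegrable_exp_mul_abs hq ha haL le_rfl).const_mul _) (hsub ha haL le_rfl)
      fun y hy => ?_
    rw [← mul_assoc, ← Real.exp_add]
    refine mul_le_of_le_one_left (abs_nonneg _) (Real.exp_le_one_iff.2 ?_)
    nlinarith [hy.1]
  rw [le_inv_mul_iff₀ (by positivity),
    ← intervalIntegral.integral_add_adjacent_intervals (hsub le_rfl ha haL) (hsub ha haL le_rfl)]
  linarith

theorem neg_sq_im_ne_zero (hre : 0 < κ.re) (him : κ.im ≠ 0) : (-κ ^ 2).im ≠ 0 := by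
  have : (-κ ^ 2).im = -2 * (κ.re * κ.im) := by rw [sq]; simp; ring
  rw [this]
  exact mul_ne_zero (by norm_num) (mul_ne_zero hre.ne' him)

/-- The common part of both estimates. -/
theorem exists_weylM_norm_sub_le (ha : 0 ≤ a) (hδ : 0 < δ) (he₁ : e₁.Admissible q₁)
    (he₂ : e₂.Admissible q₂) (hr₁ : ((a + δ : ℝ) : EReal) ≤ e₁.right)
    (hr₂ : ((a + δ : ℝ) : EReal) ≤ e₂.right)
    (hq : ∀ᵐ x ∂volume.restrict (Icc 0 a), q₁ x = q₂ x)
    (hη₁ : localL1Sup a δ q₁ ≤ η) (hη₂ : localL1Sup a δ q₂ ≤ η) (hk : 4 * η ≤ κ.re)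
    (hkδ : δ⁻¹ * Real.log 6 ≤ κ.re) (him : κ.im ≠ 0) :
    ∃ m₁ m₂ : ℂ, IsWeylM q₁ e₁ (-κ ^ 2) m₁ ∧ IsWeylM q₂ e₂ (-κ ^ 2) m₂ ∧
      ‖m₁ - m₂‖ ≤ 2 * boundF η δ κ * Real.exp (-2 * a * (κ.re - boundF η δ κ)) ∧
      ‖m₁ - m₂‖ ≤ 2 * boundF η δ κ * Real.exp (-2 * a * κ.re
        + 2 * ((a / δ + 2) * η / κ.re + a * (boundF η δ κ - 2 * η))) := by
  have hk0 : 0 < κ.re :=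
    lt_of_lt_of_le (mul_pos (inv_pos.2 hδ) (Real.log_pos (by norm_num))) hkδ
  have hz := neg_sq_im_ne_zero hk0 him
  have hL : 0 ≤ a + δ := by linarith
  obtain ⟨ψ₁, ψ₁', hψ₁⟩ := exists_weylGenerator he₁ hz
  obtain ⟨ψ₂, ψ₂', hψ₂⟩ := exists_weylGenerator he₂ hz
  have main : ∀ {q : ℝ → ℝ} {e : Endpoint} {ψ ψ' : ℝ → ℂ}, e.Admissible q →
      ((a + δ : ℝ) : EReal) ≤ e.right → localL1Sup a δ q ≤ η →
      IsWeylGenerator q e (-κ ^ 2) ψ ψ' → SolvesOn q (-κ ^ 2) 0 a ψ ψ' ∧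
        (∀ x ∈ Icc 0 a, ψ x ≠ 0) ∧ (∀ x ∈ Icc 0 a, ‖ψ' x / ψ x + κ‖ ≤ boundF η δ κ) ∧
        (∀ x ∈ Icc 0 a, ‖ψ' x / ψ x + κ‖
          ≤ 2 * tailWeight q κ.re (a + δ) x + (boundF η δ κ - 2 * η)) ∧
        IntervalIntegrable (fun x => 2 * tailWeight q κ.re (a + δ) x + (boundF η δ κ - 2 * η))
          volume 0 a ∧
        ∫ x in 0..a, (2 * tailWeight q κ.re (a + δ) x + (boundF η δ κ - 2 * η))
          ≤ (a / δ + 2) * η / κ.re + a * (boundF η δ κ - 2 * η) := by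
    intro q e ψ ψ' he hr hη hψ
    have hmem : a + δ ∈ e.interval := Endpoint.mem_interval_of_le hL hr
    have hqi := e.integrableOn he hmem
    have hqI := intervalIntegrable_of_Ioo hL hqi
    have hloc : ∀ x ∈ Icc 0 a, ∫ y in x..(x + δ), |q y| ≤ η := fun x hx =>
      integral_le_of_localL1Sup_le hδ.le hqi hη hx
    have hη0 : 0 ≤ η := le_trans
      (intervalIntegral.integral_nonneg (by linarith) fun _ _ => abs_nonneg _)
      (hloc 0 ⟨le_rfl, ha⟩)
    have hb : ∀ x ∈ Icc 0 a, _ := fun x hx =>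
      hψ.logDeriv_add_le he hδ hr hloc hk hkδ him hx
    obtain ⟨hti, htle⟩ := integral_tailWeight_le (a := a) hk0 ha (by linarith) hqI
    have hF : boundF η δ κ - 2 * η
        = 864 / 5 * (‖κ‖ ^ 2 / |κ.im|) * Real.exp (-2 * δ * κ.re) := by
      rw [boundF]; ring
    refine ⟨(hψ.isWeyl.1.solvesOn he hmem).mono hL le_rfl ha (by linarith),
      fun x hx => (hb x hx).1, fun x hx => ?_, fun x hx => ?_,
      (hti.const_mul 2).add intervalIntegrable_const, ?_⟩
    · refine (hb x hx).2.trans ?_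
      rw [boundF]
      have hle : ∫ y in 0..δ, Real.exp (-2 * κ.re * y) * |q (x + y)| ≤ η := by
        refine le_trans ?_ (hloc x hx)
        have hxi : IntervalIntegrable (fun y => q (x + y)) volume 0 δ := by
          have h1 : IntervalIntegrable q volume x (x + δ) := by
            refine hqI.mono_set ?_
            rw [uIcc_of_le (by linarith : x ≤ x + δ), uIcc_of_le hL]
            exact Icc_subset_Icc hx.1 (by linarith [hx.2])
          have h2 := h1.comp_add_left x
          rwa [sub_self, add_sub_cancel_left] at h2
        have e1 : ∫ y in x..(x + δ), |q y| = ∫ y in 0..δ, |q (x + y)| := by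
          rw [intervalIntegral.integral_comp_add_left (fun y => |q y|), add_zero]
        rw [e1]
        refine intervalIntegral.integral_mono_on hδ.le (hxi.abs.continuousOn_mul
          (by fun_prop : Continuous fun y => Real.exp (-2 * κ.re * y)).continuousOn) hxi.abs
          fun y hy => mul_le_of_le_one_left (abs_nonneg _) (Real.exp_le_one_iff.2 ?_)
        nlinarith [mul_nonneg hk0.le hy.1]
      linarith
    · refine (hb x hx).2.trans ?_
      rw [hF]
      have := integral_exp_shift_le (k := κ.re) hδ.le hx.1 (by linarith [hx.2] : x + δ ≤ a + δ) hqI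
      linarith
    · rw [intervalIntegral.integral_add (hti.const_mul 2) intervalIntegrable_const,
        intervalIntegral.integral_const_mul, intervalIntegral.integral_const, smul_eq_mul, sub_zero]
      have hA := integral_abs_le ha hδ hη0 hqi hloc
      have h1 : ∫ x in 0..a, tailWeight q κ.re (a + δ) x ≤ (2 * κ.re)⁻¹ * ((a / δ + 2) * η) :=
        htle.trans (mul_le_mul_of_nonneg_left hA (by positivity))
      have h2 : (a / δ + 2) * η / κ.re = 2 * ((2 * κ.re)⁻¹ * ((a / δ + 2) * η)) := by
        field_simp
      linarith
  obtain ⟨s₁, n₁, b₁, t₁, i₁, S₁⟩ := main he₁ hr₁ hη₁ hψ₁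
  obtain ⟨s₂, n₂, b₂, t₂, i₂, S₂⟩ := main he₂ hr₂ hη₂ hψ₂
  have hA : a ∈ Icc 0 a := ⟨ha, le_rfl⟩
  have h0 : (0 : ℝ) ∈ Icc 0 a := ⟨le_rfl, ha⟩
  refine ⟨_, _, hψ₁.isWeylM he₁ (n₁ 0 h0), hψ₂.isWeylM he₂ (n₂ 0 h0), ?_, ?_⟩
  · have := norm_logDeriv_sub_le ha hq s₁ s₂ n₁ n₂ b₁ b₂ intervalIntegrable_const
      intervalIntegrable_const (S := a * boundF η δ κ) (by simp) (by simp) (b₁ a hA) (b₂ a hA)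
    refine this.trans (le_of_eq ?_)
    congr 2; ring
  · exact norm_logDeriv_sub_le ha hq s₁ s₂ n₁ n₂ t₁ t₂ i₁ i₂ S₁ S₂ (b₁ a hA) (b₂ a hA)

/-- In a sector the real and imaginary parts are comparable to the modulus. -/
theorem sector_bounds {ε : ℝ} (hε : 0 < ε) (h1 : -(Real.pi / 2) + ε < κ.arg) (h2 : κ.arg < -ε) :
    0 < Real.sin ε ∧ Real.sin ε * ‖κ‖ ≤ κ.re ∧ Real.sin ε * ‖κ‖ ≤ |κ.im| := by
  have hpi := Real.pi_pos
  refine ⟨Real.sin_pos_of_pos_of_lt_pi hε (by linarith), ?_, ?_⟩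
  · rw [← Complex.norm_mul_cos_arg κ, mul_comm, ← Real.cos_pi_div_two_sub, ← Real.cos_neg κ.arg]
    exact mul_le_mul_of_nonneg_left
      (Real.cos_le_cos_of_nonneg_of_le_pi (by linarith) (by linarith) (by linarith))
      (norm_nonneg _)
  · refine le_trans ?_ (neg_le_abs _)
    rw [← Complex.norm_mul_sin_arg κ, mul_comm, ← mul_neg, ← Real.sin_neg]
    exact mul_le_mul_of_nonneg_left
      (Real.sin_le_sin_of_le_of_le_pi_div_two (by linarith) (by linarith) (by linarith))
      (norm_nonneg _)

theorem tendsto_mul_exp_neg {c : ℝ} (hc : 0 < c) :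
    Tendsto (fun r : ℝ => r * Real.exp (-(c * r))) atTop (𝓝 0) := by
  have h := (Real.tendsto_pow_mul_exp_neg_atTop_nhds_zero 1).comp
    (tendsto_id.const_mul_atTop hc)
  have h2 := h.const_mul c⁻¹
  rw [mul_zero] at h2
  refine h2.congr fun r => ?_
  simp only [Function.comp_apply, id, pow_one]
  field_simp

end

end Schrodinger
end

theorem theorem1p3 :
    -- the constant depends only on `ε`, `δ` and the local `L¹` bound `η`
    (∀ ε δ η : ℝ, 0 < ε → 0 < δ → ∃ C : ℝ, ∀ a : ℝ, 0 ≤ a → ∃ K₀ : ℝ,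
      ∀ (q₁ q₂ : ℝ → ℝ) (e₁ e₂ : Schrodinger.Endpoint),
        e₁.Admissible q₁ → e₂.Admissible q₂ →
        ((a + δ : ℝ) : EReal) ≤ e₁.right → ((a + δ : ℝ) : EReal) ≤ e₂.right →
        (∀ᵐ x ∂(volume.restrict (Icc 0 a)), q₁ x = q₂ x) →
        Schrodinger.localL1Sup a δ q₁ ≤ η → Schrodinger.localL1Sup a δ q₂ ≤ η →
        ∀ κ : ℂ, -(Real.pi / 2) + ε < κ.arg → κ.arg < -ε → K₀ ≤ ‖κ‖ →
          ∃ m₁ m₂ : ℂ, Schrodinger.IsWeylM q₁ e₁ (-κ ^ 2) m₁ ∧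
            Schrodinger.IsWeylM q₂ e₂ (-κ ^ 2) m₂ ∧
            ‖m₁ - m₂‖ ≤ C * Real.exp (-2 * a * κ.re)) ∧
    -- the explicit form
    (∀ (a δ η : ℝ) (q₁ q₂ : ℝ → ℝ) (e₁ e₂ : Schrodinger.Endpoint), 0 ≤ a → 0 < δ →
        e₁.Admissible q₁ → e₂.Admissible q₂ →
        ((a + δ : ℝ) : EReal) ≤ e₁.right → ((a + δ : ℝ) : EReal) ≤ e₂.right →
        (∀ᵐ x ∂(volume.restrict (Icc 0 a)), q₁ x = q₂ x) →
        η = max (Schrodinger.localL1Sup a δ q₁) (Schrodinger.localL1Sup a δ q₂) →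
        ∀ κ : ℂ, max (4 * η) (δ⁻¹ * Real.log 6) ≤ κ.re → κ.im ≠ 0 →
          ∃ m₁ m₂ : ℂ, Schrodinger.IsWeylM q₁ e₁ (-κ ^ 2) m₁ ∧
            Schrodinger.IsWeylM q₂ e₂ (-κ ^ 2) m₂ ∧
            ‖m₁ - m₂‖ ≤ 2 * Schrodinger.boundF η δ κ *
              Real.exp (-2 * a * (κ.re - Schrodinger.boundF η δ κ))) := by
  constructor
  · intro ε δ η hε hδ
    refine ⟨2 * (2 * |η| + 1) * Real.exp 2, fun a ha => ?_⟩
    by_cases hs : 0 < Real.sin ε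
    swap
    · exact ⟨0, fun q₁ q₂ e₁ e₂ _ _ _ _ _ _ _ κ h1 h2 _ =>
        absurd (Schrodinger.sector_bounds hε h1 h2).1 hs⟩
    set s := Real.sin ε with hsdef
    set τ : ℝ := 1 / (2 * (a + 1)) with hτ
    have hτ0 : 0 < τ := by positivity
    have hlim : Tendsto (fun r : ℝ => 864 / 5 * (1 / s) * (r * Real.exp (-((2 * δ * s) * r))))
        atTop (𝓝 0) := by
      simpa using (Schrodinger.tendsto_mul_exp_neg
        (by positivity : 0 < 2 * δ * s)).const_mul (864 / 5 * (1 / s))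
    have hlin : Tendsto (fun r : ℝ => s * r) atTop atTop := tendsto_id.const_mul_atTop hs
    have hev : ∀ᶠ r : ℝ in atTop, 1 ≤ r ∧ 4 * |η| ≤ s * r ∧ δ⁻¹ * Real.log 6 ≤ s * r ∧
        2 * ((a / δ + 2) * |η|) ≤ s * r ∧
        864 / 5 * (1 / s) * (r * Real.exp (-((2 * δ * s) * r))) ≤ τ :=
      (eventually_ge_atTop 1).and ((hlin.eventually_ge_atTop _).and
        ((hlin.eventually_ge_atTop _).and ((hlin.eventually_ge_atTop _).and
          ((hlim.eventually_le_const hτ0)))))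
    obtain ⟨K₀, hK₀⟩ := eventually_atTop.1 hev
    refine ⟨K₀, fun q₁ q₂ e₁ e₂ he₁ he₂ hr₁ hr₂ hq hη₁ hη₂ κ h1 h2 hκ => ?_⟩
    obtain ⟨-, hre, him⟩ := Schrodinger.sector_bounds hε h1 h2
    obtain ⟨c1, c2, c3, c4, c5⟩ := hK₀ ‖κ‖ hκ
    have hrpos : 0 < ‖κ‖ := by linarith
    have hsr : 0 < s * ‖κ‖ := by positivity
    have hkpos : 0 < κ.re := by linarith
    have himpos : 0 < |κ.im| := by linarith
    have hηle := le_abs_self η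
    obtain ⟨m₁, m₂, hm₁, hm₂, -, hle⟩ := Schrodinger.exists_weylM_norm_sub_le ha hδ he₁ he₂ hr₁ hr₂
      hq hη₁ hη₂ (by linarith) (by linarith) (abs_pos.1 himpos)
    refine ⟨m₁, m₂, hm₁, hm₂, hle.trans ?_⟩
    set G := Schrodinger.boundF η δ κ - 2 * η with hG
    have hGle : G ≤ τ := by
      refine le_trans ?_ c5
      rw [hG, Schrodinger.boundF, add_sub_cancel_left]
      have g1 : ‖κ‖ ^ 2 / |κ.im| ≤ 1 / s * ‖κ‖ := by
        rw [div_le_iff₀ himpos]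
        calc ‖κ‖ ^ 2 = 1 / s * ‖κ‖ * (s * ‖κ‖) := by field_simp
          _ ≤ _ := by gcongr
      have g2 : Real.exp (-2 * δ * κ.re) ≤ Real.exp (-(2 * δ * s * ‖κ‖)) := by
        apply Real.exp_le_exp.2
        nlinarith
      calc _ ≤ 864 / 5 * (1 / s * ‖κ‖) * Real.exp (-(2 * δ * s * ‖κ‖)) := by gcongr
        _ = _ := by ring
    have hF : Schrodinger.boundF η δ κ ≤ 2 * |η| + 1 := by
      have : τ ≤ 1 := by rw [hτ, div_le_one (by positivity)]; linarith
      linarith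
    have haG : a * G ≤ 1 / 2 := by
      calc a * G ≤ a * τ := by gcongr
        _ ≤ 1 / 2 := by
          rw [hτ, mul_one_div, div_le_div_iff₀ (by positivity) (by norm_num)]; linarith
    have hQ : (a / δ + 2) * η / κ.re ≤ 1 / 2 := by
      rw [div_le_iff₀ hkpos]
      have : (a / δ + 2) * η ≤ (a / δ + 2) * |η| := by gcongr
      linarith
    calc 2 * Schrodinger.boundF η δ κ * Real.exp (-2 * a * κ.re
          + 2 * ((a / δ + 2) * η / κ.re + a * G))
        ≤ 2 * (2 * |η| + 1) * Real.exp (-2 * a * κ.re + 2) := by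
          gcongr
          linarith
      _ = 2 * (2 * |η| + 1) * Real.exp 2 * Real.exp (-2 * a * κ.re) := by
          rw [Real.exp_add]; ring
  · intro a δ η q₁ q₂ e₁ e₂ ha hδ he₁ he₂ hr₁ hr₂ hq hη κ hκ him
    obtain ⟨m₁, m₂, hm₁, hm₂, hle, -⟩ := Schrodinger.exists_weylM_norm_sub_le ha hδ he₁ he₂ hr₁ hr₂
      hq (hη ▸ le_max_left _ _) (hη ▸ le_max_right _ _) ((le_max_left _ _).trans hκ)
      ((le_max_right _ _).trans hκ) him
    exact ⟨m₁, m₂, hm₁, hm₂, hle⟩
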